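/- Let $\mathcal H_A,\mathcal H_B$ be separable complex Hilbert spaces (of finite or infinite dimension), let $\Phi\in\mathcal H_A\otimes\mathcal H_B$ be a unit vector with reduced density $\rho=\mathrm{Tr}_B|\Phi\rangle\langle\Phi|$, and for real $x$ put $h(x)=\mathrm{Tr}\,(\rho-x)\{\rho-x\ge 0\}$, where $\{\rho-x\ge 0\}$ is the spectral projection of $\rho-x$ for $[0,\infty)$. A unit vector $\Psi\in\mathcal H_A\otimes\mathcal H_B$ is called a maximally entangled state of size $L$ if its reduced density on $\mathcal H_A$ equals $\frac1L$ times the orthogonal projection onto an $L$-dimensional subspace. A probabilistic fixed-length entanglement concentration (PFLEC) of $\Phi$ is a two-valued instrument $I=\{I_0,I_1\}$ ($1$ = success, $0$ = failure) on $\mathcal H_A\otimes\mathcal H_B$ that is implemented by local operations and classical communication (LOCC) and for which $I_1(|\Phi\rangle\langle\Phi|)/\mathrm{Tr}\,I_1(|\Phi\rangle\langle\Phi|)$ is a maximally entangled pure state; the size of that state is denoted by $L(I)$. Here an LOCC implementation consists of finitely many rounds; in each round one of the two parties performs a local measurement (with countably many outcomes) that may depend on all earlier outcomes, and announces its outcome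 to the other party; at the end a value in $\{0,1\}$ is determined by the outcomes. Then, for every real $x$ with $0<x\le\lambda_{\max}(\rho)$, where $\lambda_{\max}(\rho)$ is the largest eigenvalue of $\rho$, $$\max\bigl\{L(I)\;:\; I=\{I_0,I_1\}\text{ is a PFLEC of }\Phi,\ \mathrm{Tr}\,I_0(|\Phi\rangle\langle\Phi|)\le h(x)\bigr\}=\Bigl\lfloor\frac{1-h(x)}{x}\Bigr\rfloor ,$$ and in particular the maximum is attained. -/

import Mathlib

open scoped TensorProduct InnerProductSpace

universe u v

/-- A quantum system: a separable complex Hilbert space (of finite or infinite dimension). -/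
structure QSystem where
  carrier : Type u
  [normedAddCommGroup : NormedAddCommGroup carrier]
  [innerProductSpace : InnerProductSpace ℂ carrier]
  [completeSpace : CompleteSpace carrier]
  [separableSpace : TopologicalSpace.SeparableSpace carrier]

namespace QSystem

instance : CoeSort QSystem.{u} (Type u) := ⟨QSystem.carrier⟩

attribute [instance] normedAddCommGroup innerProductSpace completeSpace separableSpace

end QSystem

namespace Entanglement

noncomputable section

/-- The Hilbert space tensor product `A ⊗ B`: the completion of the algebraic tensor product for
the inner product `⟪a ⊗ b, a' ⊗ b'⟫ = ⟪a, a'⟫ * ⟪b, b'⟫`. -/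
abbrev Tensor (A : QSystem.{u}) (B : QSystem.{v}) : Type (max u v) :=
  UniformSpace.Completion ((A : Type u) ⊗[ℂ] (B : Type v))

/-- Bounded operators on `A ⊗ B`. -/
abbrev Op (A : QSystem.{u}) (B : QSystem.{v}) : Type (max u v) :=
  Tensor A B →L[ℂ] Tensor A B

/-- The operator `X ⊗ Y` on the Hilbert space tensor product. -/
def tensorOp {A A₁ : QSystem.{u}} {B B₁ : QSystem.{v}}
    (X : A →L[ℂ] A₁) (Y : B →L[ℂ] B₁) : Tensor A B →L[ℂ] Tensor A₁ B₁ :=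
  (TensorProduct.mapL X Y).completion

/-- The operator `a ↦ a ⊗ b`, from `A` to `A ⊗ B`. -/
def tensorRight (A : QSystem.{u}) {B : QSystem.{v}} (b : B) : A →L[ℂ] Tensor A B :=
  UniformSpace.Completion.toComplL ∘L (TensorProduct.mkL ℂ A B).flip b

/-- The (non-normalized) pure state `|ψ⟩⟨ψ|`. -/
def pureState {H : Type*} [NormedAddCommGroup H] [InnerProductSpace ℂ H] (ψ : H) : H →L[ℂ] H :=
  InnerProductSpace.rankOne ℂ ψ ψ

section Trace

variable (H : Type*) [NormedAddCommGroup H] [InnerProductSpace ℂ H] [CompleteSpace H]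

/-- The index set of a Hilbert basis of `H`. -/
def basisIndex : Set H := (exists_hilbertBasis ℂ H).choose

/-- A Hilbert basis of `H`. -/
def basis : HilbertBasis (basisIndex H) ℂ H := (exists_hilbertBasis ℂ H).choose_spec.choose

variable {H}

/-- The trace `∑ i, ⟪e i, T (e i)⟫` of a trace class operator `T` (the sum does not depend on the
Hilbert basis `e`). It is only used for positive trace class operators. -/
def trace (T : H →L[ℂ] H) : ℂ := ∑' i, ⟪basis H i, T (basis H i)⟫_ℂ

end Trace

/-- The partial trace `∑ j, (1 ⊗ ⟨f j|) T (1 ⊗ |f j⟩)` over `B` of a trace class operator `T`, for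
a Hilbert basis `f` of `B` (on which the sum does not depend). It is only used for pure states, for
which the series converges absolutely in operator norm. -/
def partialTrace {A : QSystem.{u}} {B : QSystem.{v}} (T : Op A B) : A →L[ℂ] A :=
  ∑' j, (ContinuousLinearMap.adjoint (tensorRight A (basis B j)) ∘L T) ∘L
    tensorRight A (basis B j)

/-- The reduced density `ρ = Tr_B |Φ⟩⟨Φ|` of a vector `Φ` of `A ⊗ B`. -/
def reducedDensity {A : QSystem.{u}} {B : QSystem.{v}} (Φ : Tensor A B) : A →L[ℂ] A :=
  partialTrace (pureState Φ)

/-- The function `h(x) = Tr (ρ - x){ρ - x ≥ 0}`, where `{ρ - x ≥ 0}` is the spectral projection of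
`ρ - x` for `[0, ∞)`. The operator `(ρ - x){ρ - x ≥ 0}` is the value at `ρ` of the continuous
function `t ↦ (t - x) * 1_{t - x ≥ 0}`. -/
def h {A : QSystem.{u}} (ρ : A →L[ℂ] A) (x : ℝ) : ℝ :=
  (trace (cfc (fun t : ℝ => (t - x) * Set.indicator {s : ℝ | 0 ≤ s - x} 1 t) ρ)).re

/-- `Ψ` is a maximally entangled state of size `L`, on a subspace `V ⊗ W` of `A ⊗ B`: a unit vector
whose reduced density is the completely mixed state on an `L`-dimensional subspace `V` of `A`.
(Then `W` is the support of the reduced density on the other side, which has the same dimension.) -/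
def IsMaximallyEntangled {A : QSystem.{u}} {B : QSystem.{v}} (Ψ : Tensor A B) (L : ℕ) :
    Prop :=
  ‖Ψ‖ = 1 ∧ ∃ (V : Submodule ℂ A) (_ : FiniteDimensional ℂ V),
    Module.finrank ℂ V = L ∧ reducedDensity Ψ = ((L : ℂ)⁻¹) • V.starProjection

/-- A local measurement from `A` to `A₁`: countably many outcomes `j` with measurement (Kraus)
operators `K j` such that `∑ j, (K j)* (K j) = 1`; that is, on every unit vector the outcome
probabilities `‖K j a‖ ^ 2` have sum one. Finitely many outcomes are the case where all but
finitely many `K j` vanish. -/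
structure Measurement (A A₁ : QSystem.{u}) where
  K : ℕ → A →L[ℂ] A₁
  complete : ∀ a : A, HasSum (fun j => ‖K j a‖ ^ 2) (‖a‖ ^ 2)

/-- Two-valued LOCC protocols with at most `n` rounds, from the system `A ⊗ B` to the system
`A' ⊗ B'`. In every round one of the parties performs a measurement on her or his side (the local
system may change, so that ancillas may be added or discarded) and announces the outcome `j`, on
which the remaining protocol `next j` may depend. At the end a value in `{0, 1}` is reported, which
may depend on all the outcomes; everything else is forgotten. A general local operation
`T ↦ ∑ j, K j T (K j)*` is a measurement whose outcome is not used. -/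
inductive LOCC (A' : QSystem.{u}) (B' : QSystem.{v}) :
    ℕ → QSystem.{u} → QSystem.{v} → Type (max (u + 1) (v + 1))
  | finish {n : ℕ} (value : Fin 2) : LOCC A' B' n A' B'
  | alice {n : ℕ} {A : QSystem.{u}} {B : QSystem.{v}} (A₁ : QSystem.{u})
      (M : Measurement A A₁) (next : ℕ → LOCC A' B' n A₁ B) : LOCC A' B' (n + 1) A B
  | bob {n : ℕ} {A : QSystem.{u}} {B : QSystem.{v}} (B₁ : QSystem.{v})
      (M : Measurement B B₁) (next : ℕ → LOCC A' B' n A B₁) : LOCC A' B' (n + 1) A B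

/-- The instrument `{I 0, I 1}` implemented by an LOCC protocol: `I i T` is the non-normalized final
state for the value `i` when the initial state is `T`. For positive trace class `T` all the series
converge absolutely in operator norm. -/
def LOCC.instrument {A' : QSystem.{u}} {B' : QSystem.{v}} :
    ∀ {n : ℕ} {A : QSystem.{u}} {B : QSystem.{v}},
      LOCC A' B' n A B → Fin 2 → Op A B → Op A' B'
  | _, _, _, .finish value, i, T => if i = value then T else 0
  | _, _, B, .alice _ M next, i, T =>
      ∑' j, (next j).instrument i
        ((tensorOp (M.K j) (ContinuousLinearMap.id ℂ B) ∘L T) ∘L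
          ContinuousLinearMap.adjoint (tensorOp (M.K j) (ContinuousLinearMap.id ℂ B)))
  | _, A, _, .bob _ M next, i, T =>
      ∑' j, (next j).instrument i
        ((tensorOp (ContinuousLinearMap.id ℂ A) (M.K j) ∘L T) ∘L
          ContinuousLinearMap.adjoint (tensorOp (ContinuousLinearMap.id ℂ A) (M.K j)))

/-- The two-valued LOCC instrument `I = {I 0, I 1}` implemented by `P` is a probabilistic
fixed-length entanglement concentration of `Φ` whose final maximally entangled state has size `L`:
the normalized state `I 1 (Φ) / Tr I 1 (Φ)` is a maximally entangled pure state of size `L`. -/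
def IsPFLEC {n : ℕ} {A : QSystem.{u}} {B : QSystem.{v}}
    (P : LOCC A B n A B) (Φ : Tensor A B) (L : ℕ) : Prop :=
  ∃ Ψ : Tensor A B, IsMaximallyEntangled Ψ L ∧
    (trace (P.instrument 1 (pureState Φ)))⁻¹ • P.instrument 1 (pureState Φ) = pureState Ψ

/-- The failure probability `Tr I 0 (Φ)`. -/
def failureProb {n : ℕ} {A : QSystem.{u}} {B : QSystem.{v}}
    (P : LOCC A B n A B) (Φ : Tensor A B) : ℝ :=
  (trace (P.instrument 0 (pureState Φ))).re

end

end Entanglement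

/-! Let `p i` be the eigenvalues of `ρ`, i.e. the squared Schmidt coefficients of `Φ`. Then `h x = ∑
max (p i - x) 0`, so `t = 1 - h x = ∑ min (p i) x` is the mass left after capping the spectrum at
`x`.

Upper bound. Let `T = {i | x ≤ p i}`, `k = |T|`, and let `χ` be `Φ` truncated to the Schmidt terms
in `T`, so that `‖Φ - χ‖² = t - k x`. Each branch of an LOCC protocol acts by an operator that does
not raise the Schmidt rank, and the squared norms of the branches add up to that of the input
(`LOCC.exists_branches`). A successful branch sends `Φ` to `c Ψ` and `χ` to a vector of Schmidt rank
at most `k`, and these differ by at least `|c|² (1 - k/L)` in squared norm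
(`IsMaximallyEntangled.le_norm_sub_sq`). Summing over branches gives `s (1 - k/L) ≤ t - k x` for the
success probability `s`. As `s ≥ t`, this forces `L x ≤ t`.

Attainment. If `L x ≤ t`, the numbers `q i = (L/t) min (p i) x` lie in `[0, 1]` and sum to `L`, so
they are the inclusion probabilities of a random set `S` with exactly `L` elements
(`exists_sampling`). Alice's successful outcomes select such a set and flatten the Schmidt
coefficients on it. Relabelling on both sides turns every outcome into the same state, with total
probability `t` (`exists_isPFLEC`). -/

namespace Entanglement

noncomputable section

/-! ### Pure states and traces of their sums -/

section PureState

variable {H H' : Type*} [NormedAddCommGroup H] [InnerProductSpace ℂ H]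
  [NormedAddCommGroup H'] [InnerProductSpace ℂ H']

theorem pureState_apply (ψ φ : H) : pureState ψ φ = ⟪ψ, φ⟫_ℂ • ψ := rfl

theorem pureState_zero : pureState (0 : H) = 0 := by
  ext φ; simp [pureState_apply]

theorem norm_pureState (ψ : H) : ‖pureState ψ‖ = ‖ψ‖ ^ 2 := by
  simp [pureState, sq]

theorem pureState_smul (c : ℂ) (ψ : H) : pureState (c • ψ) = ((‖c‖ ^ 2 : ℝ) : ℂ) • pureState ψ := by
  ext φ
  simp only [pureState_apply, inner_smul_left, _root_.smul_apply, smul_smul]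
  congr 1
  rw [mul_right_comm, Complex.conj_mul']
  push_cast; ring

theorem comp_pureState_comp_adjoint [CompleteSpace H] [CompleteSpace H'] (X : H →L[ℂ] H') (ψ : H) :
    (X ∘L pureState ψ) ∘L ContinuousLinearMap.adjoint X = pureState (X ψ) := by
  ext φ
  simp [pureState_apply, ContinuousLinearMap.adjoint_inner_right]

theorem summable_pureState {ι : Type*} [CompleteSpace H] {v : ι → H}
    (hv : Summable fun i => ‖v i‖ ^ 2) : Summable fun i => pureState (v i) :=
  Summable.of_norm (by simpa only [norm_pureState] using hv)

theorem hasSum_norm_inner_sq {ι : Type*} (b : HilbertBasis ι ℂ H) (ψ : H) :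
    HasSum (fun i => ‖⟪b i, ψ⟫_ℂ‖ ^ 2) (‖ψ‖ ^ 2) := by
  have h := b.hasSum_inner_mul_inner ψ ψ
  have h' := Complex.hasSum_re h
  rw [← RCLike.re_eq_complex_re, inner_self_eq_norm_sq] at h'
  convert! h' using 2 with i
  rw [← inner_conj_symm ψ (b i), Complex.conj_mul', RCLike.re_eq_complex_re]
  norm_cast

theorem inner_pureState_self (ψ φ : H) :
    ⟪φ, pureState ψ φ⟫_ℂ = ((‖⟪φ, ψ⟫_ℂ‖ ^ 2 : ℝ) : ℂ) := by
  rw [pureState_apply, inner_smul_right, ← inner_conj_symm ψ φ, Complex.conj_mul']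
  norm_cast

/-- Iterated sums of nonnegative reals may be interchanged. -/
theorem hasSum_comm_of_nonneg {ι κ : Type*} {f : ι → κ → ℝ} {r : ι → ℝ} {s : κ → ℝ} {a : ℝ}
    (hf : ∀ i j, 0 ≤ f i j) (hr : ∀ i, HasSum (f i) (r i)) (ha : HasSum r a)
    (hs : ∀ j, HasSum (fun i => f i j) (s j)) : HasSum s a := by
  have hsum : Summable (fun p : ι × κ => f p.1 p.2) := by
    rw [summable_prod_of_nonneg (fun p => hf p.1 p.2)]
    exact ⟨fun i => (hr i).summable, by simpa only [fun i => (hr i).tsum_eq] using ha.summable⟩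
  have h1 : HasSum (fun p : ι × κ => f p.1 p.2) a := by
    rw [← (hsum.hasSum.prod_fiberwise hr).unique ha]
    exact hsum.hasSum
  have h2 : HasSum (fun p : κ × ι => f p.2 p.1) a := by
    rw [← (Equiv.prodComm ι κ).hasSum_iff]
    exact h1
  exact h2.prod_fiberwise hs

theorem hasSum_swap_of_nonneg {ι κ : Type*} {f : ι → κ → ℝ} {r : ι → ℝ} {a : ℝ}
    (hf : ∀ i j, 0 ≤ f i j) (hr : ∀ i, HasSum (f i) (r i)) (ha : HasSum r a) :
    HasSum (fun j => ∑' i, f i j) a := by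
  refine hasSum_comm_of_nonneg hf hr ha fun j => Summable.hasSum ?_
  refine Summable.of_nonneg_of_le (fun i => hf i j) (fun i => ?_) ha.summable
  exact le_hasSum (hr i) j fun k _ => hf i k

/-- Parseval for each `v i`, then Tonelli. All traces below are computed in this way, without a
theory of trace class operators. -/
theorem trace_of_hasSum_pureState [CompleteSpace H] {ι : Type*} {v : ι → H} {T : H →L[ℂ] H} {a : ℝ}
    (hv : HasSum (fun i => ‖v i‖ ^ 2) a) (hT : HasSum (fun i => pureState (v i)) T) :
    trace T = a := by
  have h1 : ∀ j, HasSum (fun i => ((‖⟪basis H j, v i⟫_ℂ‖ ^ 2 : ℝ) : ℂ))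
      ⟪basis H j, T (basis H j)⟫_ℂ := fun j => by
    simp_rw [← inner_pureState_self]
    have := hT.mapL (ContinuousLinearMap.apply ℂ H (basis H j))
    exact this.mapL (innerSL ℂ (basis H j))
  have h2 := hasSum_swap_of_nonneg (f := fun i j => ‖⟪basis H j, v i⟫_ℂ‖ ^ 2)
    (fun _ _ => by positivity) (fun i => hasSum_norm_inner_sq (basis H) (v i)) hv
  have h3 := Complex.hasSum_ofReal.mpr h2
  rw [trace, ← h3.tsum_eq]
  congr 1
  ext j
  rw [← (h1 j).tsum_eq, Complex.ofReal_tsum]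

end PureState

/-! ### The Hilbert space tensor product and partial inner products -/

section Tensor

variable {A A₁ : QSystem.{u}} {B B₁ : QSystem.{v}}

/-- The elementary tensor `a ⊗ b` in the Hilbert space tensor product. -/
def tprod (a : A) (b : B) : Tensor A B := ((a ⊗ₜ[ℂ] b : (A : Type u) ⊗[ℂ] (B : Type v)) : Tensor A B)

theorem tensorRight_apply (a : A) (b : B) : tensorRight A b a = tprod a b := rfl

/-- The operator `b ↦ a ⊗ b`, from `B` to `A ⊗ B`. -/
def tensorLeft (B : QSystem.{v}) (a : A) : B →L[ℂ] Tensor A B :=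
  UniformSpace.Completion.toComplL ∘L TensorProduct.mkL ℂ A B a

theorem tensorLeft_apply (a : A) (b : B) : tensorLeft B a b = tprod a b := rfl

theorem tensorOp_tprod (X : A →L[ℂ] A₁) (Y : B →L[ℂ] B₁) (a : A) (b : B) :
    tensorOp X Y (tprod a b) = tprod (X a) (Y b) := by
  simp [tensorOp, tprod, ContinuousLinearMap.completion_apply_coe]

theorem inner_tprod (a a' : A) (b b' : B) :
    ⟪tprod a b, tprod a' b'⟫_ℂ = ⟪a, a'⟫_ℂ * ⟪b, b'⟫_ℂ := by
  simp [tprod, UniformSpace.Completion.inner_coe]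

/-- Bounded operators on `A ⊗ B` are determined by their values on elementary tensors. -/
theorem clm_ext_tprod {H : Type*} [NormedAddCommGroup H] [NormedSpace ℂ H]
    {S T : Tensor A B →L[ℂ] H} (h : ∀ a b, S (tprod a b) = T (tprod a b)) : S = T := by
  ext φ
  induction φ using UniformSpace.Completion.induction_on with
  | hp => exact isClosed_eq S.continuous T.continuous
  | ih t =>
    induction t using TensorProduct.induction_on with
    | zero => simp only [UniformSpace.Completion.coe_zero, map_zero]
    | tmul a b => exact h a b
    | add s t hs ht => simp only [UniformSpace.Completion.coe_add, map_add, hs, ht]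

theorem tprod_add_left (a a' : A) (b : B) : tprod (a + a') b = tprod a b + tprod a' b := by
  simp_rw [← tensorRight_apply, map_add]

theorem tprod_smul_left (c : ℂ) (a : A) (b : B) : tprod (c • a) b = c • tprod a b := by
  simp_rw [← tensorRight_apply, map_smul]

theorem tprod_smul_right (c : ℂ) (a : A) (b : B) : tprod a (c • b) = c • tprod a b := by
  simp_rw [← tensorLeft_apply, map_smul]

/-- The partial inner product `(⟨a| ⊗ 1) φ`, a vector of `B`. -/
def contract (a : A) (φ : Tensor A B) : B := ContinuousLinearMap.adjoint (tensorLeft B a) φ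

theorem inner_contract_right (a : A) (b : B) (φ : Tensor A B) :
    ⟪b, contract a φ⟫_ℂ = ⟪tprod a b, φ⟫_ℂ := by
  rw [contract, ContinuousLinearMap.adjoint_inner_right, tensorLeft_apply]

theorem contract_tprod (a a' : A) (b : B) : contract a (tprod a' b) = ⟪a, a'⟫_ℂ • b := by
  refine ext_inner_left ℂ fun b' => ?_
  rw [inner_contract_right, inner_tprod, inner_smul_right]

/-- `(|a⟩⟨a'| ⊗ 1) φ = a ⊗ (⟨a'| ⊗ 1) φ`. -/
theorem tensorOp_rankOne_left (a : A₁) (a' : A) (φ : Tensor A B) :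
    tensorOp (InnerProductSpace.rankOne ℂ a a') (ContinuousLinearMap.id ℂ B) φ =
      tprod a (contract a' φ) := by
  have : tensorOp (InnerProductSpace.rankOne ℂ a a') (ContinuousLinearMap.id ℂ B) =
      tensorLeft B a ∘L ContinuousLinearMap.adjoint (tensorLeft B a') := by
    refine clm_ext_tprod fun c b => ?_
    change _ = tprod a (contract a' (tprod c b))
    rw [tensorOp_tprod, contract_tprod, tprod_smul_right, InnerProductSpace.rankOne_apply,
      tprod_smul_left]
    rfl
  exact congrArg (fun T => T φ) this

theorem tensorOp_add_left (X X' : A →L[ℂ] A₁) (Y : B →L[ℂ] B₁) :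
    tensorOp (X + X') Y = tensorOp X Y + tensorOp X' Y :=
  clm_ext_tprod fun a b => by
    simp [tensorOp_tprod, tprod_add_left]

theorem tensorOp_smul_left (c : ℂ) (X : A →L[ℂ] A₁) (Y : B →L[ℂ] B₁) :
    tensorOp (c • X) Y = c • tensorOp X Y :=
  clm_ext_tprod fun a b => by
    simp [tensorOp_tprod, tprod_smul_left]

theorem tensorOp_zero_left (Y : B →L[ℂ] B₁) : tensorOp (0 : A →L[ℂ] A₁) Y = 0 := by
  simpa using tensorOp_smul_left 0 (0 : A →L[ℂ] A₁) Y

theorem tensorOp_sum_left {ι : Type*} (s : Finset ι) (X : ι → A →L[ℂ] A₁) (Y : B →L[ℂ] B₁) :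
    tensorOp (∑ i ∈ s, X i) Y = ∑ i ∈ s, tensorOp (X i) Y := by
  classical
  induction s using Finset.induction_on with
  | empty => simp [tensorOp_zero_left]
  | insert i s hi ih => rw [Finset.sum_insert hi, Finset.sum_insert hi, tensorOp_add_left, ih]

/-- Products of the vectors of two Hilbert bases form a Hilbert basis of the tensor product. -/
theorem exists_prod_hilbertBasis {ι κ : Type*} (e : HilbertBasis ι ℂ A) (f : HilbertBasis κ ℂ B) :
    ∃ b : HilbertBasis (ι × κ) ℂ (Tensor A B), ∀ p, b p = tprod (e p.1) (f p.2) := by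
  classical
  have ho : Orthonormal ℂ (fun p : ι × κ => tprod (e p.1) (f p.2)) := by
    rw [orthonormal_iff_ite]
    rintro ⟨i, j⟩ ⟨i', j'⟩
    rw [inner_tprod, orthonormal_iff_ite.mp e.orthonormal, orthonormal_iff_ite.mp f.orthonormal]
    simp [← ite_and]
    congr 1
    simp [and_comm]
  have hsp : (Submodule.span ℂ (Set.range fun p : ι × κ => tprod (e p.1) (f p.2)))ᗮ = ⊥ := by
    rw [eq_bot_iff]
    intro φ hφ
    rw [Submodule.mem_orthogonal] at hφ
    have h0 : ∀ i j, ⟪tprod (e i) (f j), φ⟫_ℂ = 0 := fun i j =>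
      hφ _ (Submodule.subset_span ⟨(i, j), rfl⟩)
    -- Orthogonality to all `e i ⊗ f j` extends to `e i ⊗ b`, then to `a ⊗ b`, and elementary
    -- tensors determine the functional `⟪φ, ·⟫`.
    have h1 : ∀ i, contract (e i) φ = 0 := fun i => by
      refine f.repr.injective ?_
      ext j
      rw [f.repr_apply_apply, inner_contract_right, h0]
      simp
    have h2 : ∀ a b, ⟪tprod a b, φ⟫_ℂ = 0 := fun a b => by
      have : ContinuousLinearMap.adjoint (tensorRight A b) φ = 0 := by
        refine e.repr.injective ?_
        ext i
        rw [e.repr_apply_apply, ContinuousLinearMap.adjoint_inner_right, tensorRight_apply,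
          ← inner_contract_right, h1]
        simp
      rw [← tensorRight_apply, ← ContinuousLinearMap.adjoint_inner_right, this, inner_zero_right]
    have h3 : innerSL ℂ φ = 0 := clm_ext_tprod fun a b => by
      rw [innerSL_apply_apply, ← inner_conj_symm, h2, map_zero, zero_apply]
    have : ⟪φ, φ⟫_ℂ = 0 := by simpa using congrArg (fun T => T φ) h3
    simpa using this
  exact ⟨HilbertBasis.mkOfOrthogonalEqBot ho hsp, fun p => by
    rw [HilbertBasis.coe_mkOfOrthogonalEqBot]⟩

theorem hasSum_norm_contract_sq {ι : Type*} (e : HilbertBasis ι ℂ A) (φ : Tensor A B) :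
    HasSum (fun i => ‖contract (e i) φ‖ ^ 2) (‖φ‖ ^ 2) := by
  obtain ⟨b, hb⟩ := exists_prod_hilbertBasis e (basis B)
  refine (hasSum_norm_inner_sq b φ).prod_fiberwise fun i => ?_
  simp_rw [hb, ← inner_contract_right]
  exact hasSum_norm_inner_sq (basis B) _

theorem hasSum_norm_adjoint_tensorRight_sq {κ : Type*} (f : HilbertBasis κ ℂ B) (φ : Tensor A B) :
    HasSum (fun j => ‖ContinuousLinearMap.adjoint (tensorRight A (f j)) φ‖ ^ 2) (‖φ‖ ^ 2) := by
  obtain ⟨b, hb⟩ := exists_prod_hilbertBasis (basis A) f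
  have := (Equiv.prodComm κ (basisIndex A)).hasSum_iff.mpr (hasSum_norm_inner_sq b φ)
  refine this.prod_fiberwise fun j => ?_
  simp only [Function.comp_apply, Equiv.prodComm_apply, Prod.swap_prod_mk, hb]
  simp_rw [← tensorRight_apply, ← ContinuousLinearMap.adjoint_inner_right]
  exact hasSum_norm_inner_sq (basis A) _

end Tensor

/-! ### The reduced density as a compact self-adjoint operator -/

section ReducedDensity

variable {A : QSystem.{u}} {B : QSystem.{v}}

theorem hasSum_reducedDensity (φ : Tensor A B) :
    HasSum (fun j => pureState (ContinuousLinearMap.adjoint (tensorRight A (basis B j)) φ))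
      (reducedDensity φ) := by
  have hs := summable_pureState (hasSum_norm_adjoint_tensorRight_sq (basis B) φ).summable
  convert! hs.hasSum using 1
  rw [reducedDensity, partialTrace]
  congr 1
  ext1 j
  rw [← comp_pureState_comp_adjoint, ContinuousLinearMap.adjoint_adjoint]

/-- Parseval in `B`: `ρ` is the Gram operator of the partial inner products. The arguments are
exchanged on the right because `contract` is antilinear in its first argument. -/
theorem inner_reducedDensity (φ : Tensor A B) (a a' : A) :
    ⟪a, reducedDensity φ a'⟫_ℂ = ⟪contract a' φ, contract a φ⟫_ℂ := by
  have h1 := ((hasSum_reducedDensity φ).mapL (ContinuousLinearMap.apply ℂ A a')).mapL (innerSL ℂ a)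
  have h2 := (basis B).hasSum_inner_mul_inner (contract a' φ) (contract a φ)
  refine h1.unique ?_
  convert! h2 using 2 with j
  rw [inner_contract_right, ← inner_conj_symm (contract a' φ), inner_contract_right]
  simp only [ContinuousLinearMap.apply_apply, pureState_apply, innerSL_apply_apply,
    inner_smul_right, ContinuousLinearMap.adjoint_inner_right,
    ContinuousLinearMap.adjoint_inner_left, tensorRight_apply]
  rw [inner_conj_symm]

theorem isCompactOperator_pureState {H : Type*} [NormedAddCommGroup H] [InnerProductSpace ℂ H]
    (ψ : H) : IsCompactOperator (pureState ψ) := by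
  have h : IsCompactOperator (ContinuousLinearMap.toSpanSingleton ℂ ψ : ℂ → H) :=
    isCompactOperator_of_locallyCompactSpace_rng (ContinuousLinearMap.toSpanSingleton ℂ ψ)
  exact h.comp_clm (innerSL ℂ ψ)

theorem isCompactOperator_reducedDensity (φ : Tensor A B) :
    IsCompactOperator (reducedDensity φ) := by
  refine isCompactOperator_of_tendsto (hasSum_reducedDensity φ) (Filter.Eventually.of_forall ?_)
  intro s
  induction s using Finset.cons_induction with
  | empty => simpa using isCompactOperator_zero
  | cons j s hj ih =>
    rw [Finset.sum_cons]
    exact (isCompactOperator_pureState _).add ih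

theorem isSymmetric_reducedDensity (φ : Tensor A B) :
    (reducedDensity φ : A →ₗ[ℂ] A).IsSymmetric := fun a a' => by
  simp only [ContinuousLinearMap.coe_coe]
  rw [inner_reducedDensity, ← inner_conj_symm, inner_reducedDensity, inner_conj_symm]

end ReducedDensity

/-! ### Spectral theory of compact self-adjoint operators -/

/-- The spectral theorem: a compact self-adjoint operator has a Hilbert basis of eigenvectors. -/
theorem exists_hilbertBasis_eigenvectors {H : Type u} [NormedAddCommGroup H]
    [InnerProductSpace ℂ H] [CompleteSpace H] {T : H →L[ℂ] H} (hc : IsCompactOperator T)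
    (hs : (T : H →ₗ[ℂ] H).IsSymmetric) :
    ∃ (ι : Type u) (e : HilbertBasis ι ℂ H) (p : ι → ℝ), ∀ i, T (e i) = (p i : ℂ) • e i := by
  have hclosed : ∀ μ : ℂ, IsClosed (Module.End.eigenspace (T : Module.End ℂ H) μ : Set H) := by
    intro μ
    have : (Module.End.eigenspace (T : Module.End ℂ H) μ : Set H) = {v | T v = μ • v} := by
      ext v; simp
    rw [this]
    exact isClosed_eq T.continuous (continuous_const_smul μ)
  have hcomp : ∀ μ : ℂ, CompleteSpace (Module.End.eigenspace (T : Module.End ℂ H) μ) := fun μ =>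
    (hclosed μ).completeSpace_coe
  choose w b hb using fun μ : ℂ => exists_hilbertBasis ℂ (Module.End.eigenspace (T : Module.End ℂ H) μ)
  have ho : Orthonormal ℂ (fun x : (Σ μ : ℂ, w μ) => ((b x.1 x.2 : _) : H)) :=
    hs.orthogonalFamily_eigenspaces.orthonormal_sigma_orthonormal fun μ => (b μ).orthonormal
  have hsp : (Submodule.span ℂ (Set.range fun x : (Σ μ : ℂ, w μ) => ((b x.1 x.2 : _) : H)))ᗮ = ⊥ := by
    rw [eq_bot_iff, ← ContinuousLinearMap.orthogonalComplement_iSup_eigenspaces_eq_bot hc hs]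
    intro v hv
    rw [Submodule.mem_orthogonal] at hv
    rw [← Submodule.iInf_orthogonal, Submodule.mem_iInf]
    intro μ
    rw [Submodule.mem_orthogonal']
    intro y hy
    have h1 := ((b μ).hasSum_repr ⟨y, hy⟩).mapL
      (innerSL ℂ v ∘L (Module.End.eigenspace (T : Module.End ℂ H) μ).subtypeL)
    refine h1.unique ?_
    convert! hasSum_zero using 2 with i
    have h2 := hv _ (Submodule.subset_span ⟨⟨μ, i⟩, rfl⟩)
    rw [← inner_conj_symm] at h2
    simp only [map_smul, ContinuousLinearMap.comp_apply, Submodule.subtypeL_apply,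
      innerSL_apply_apply]
    rw [(map_eq_zero _).mp h2, smul_zero]
  -- The index set is the union of the bases of all complex eigenspaces, most of them empty; those
  -- that occur belong to real `μ` by symmetry.
  refine ⟨_, HilbertBasis.mkOfOrthogonalEqBot ho hsp, fun x => x.1.re, fun x => ?_⟩
  rw [HilbertBasis.coe_mkOfOrthogonalEqBot]
  have hmem : T (b x.1 x.2 : H) = x.1 • (b x.1 x.2 : H) :=
    Module.End.mem_eigenspace_iff.mp (b x.1 x.2).2
  have hne : (b x.1 x.2 : H) ≠ 0 := ho.ne_zero x
  have hreal := hs.conj_eigenvalue_eq_self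
    (Module.End.hasEigenvalue_of_hasEigenvector ⟨(b x.1 x.2).2, hne⟩)
  rw [hmem, Complex.conj_eq_iff_re.mp hreal]

/-- Orthonormal vectors are `√2` apart, so balls of radius `1/2` around them are disjoint.
Countability of the Schmidt index set is what sampling needs later. -/
theorem countable_of_orthonormal {H ι : Type*} [NormedAddCommGroup H] [InnerProductSpace ℂ H]
    [TopologicalSpace.SeparableSpace H] {v : ι → H} (hv : Orthonormal ℂ v) : Countable ι := by
  refine Pairwise.countable_of_isOpen_disjoint (s := fun i => Metric.ball (v i) (1 / 2)) ?_
    (fun _ => Metric.isOpen_ball) (fun i => ⟨v i, Metric.mem_ball_self (by norm_num)⟩)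
  intro i j hij
  refine Metric.ball_disjoint_ball ?_
  have h : ‖v i - v j‖ ^ 2 = 2 := by
    rw [@norm_sub_sq ℂ, hv.2 hij, hv.1, hv.1]
    norm_num
  rw [dist_eq_norm]
  nlinarith [norm_nonneg (v i - v j)]

theorem clm_ext_hilbertBasis {H H' ι : Type*} [NormedAddCommGroup H] [InnerProductSpace ℂ H]
    [NormedAddCommGroup H'] [NormedSpace ℂ H'] (b : HilbertBasis ι ℂ H) {S T : H →L[ℂ] H'}
    (h : ∀ i, S (b i) = T (b i)) : S = T := by
  refine ContinuousLinearMap.ext_on (Submodule.dense_iff_topologicalClosure_eq_top.mpr b.dense_span)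
    ?_
  rintro _ ⟨i, rfl⟩
  exact h i

/-- The continuous functional calculus on an eigenvector. -/
theorem cfc_apply_eigenvector {H : Type*} [NormedAddCommGroup H] [InnerProductSpace ℂ H]
    [CompleteSpace H] {T : H →L[ℂ] H} (hT : IsSelfAdjoint T) {f : ℝ → ℝ} (hf : Continuous f)
    {v : H} {μ : ℝ} (hv : T v = (μ : ℂ) • v) : cfc f T v = (f μ : ℂ) • v := by
  by_cases h0 : v = 0
  · simp [h0]
  have hμ : μ ∈ spectrum ℝ T := by
    rw [spectrum.mem_iff]
    intro hu
    obtain ⟨S, hS⟩ := hu.exists_left_inv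
    have h1 : (algebraMap ℝ (H →L[ℂ] H) μ - T) v = 0 := by
      rw [sub_apply, hv, Algebra.algebraMap_eq_smul_one]
      simp
    have h2 := congrArg (fun R => R v) hS
    rw [ContinuousLinearMap.mul_def] at h2
    simp only [ContinuousLinearMap.comp_apply, h1, map_zero, one_apply_eq_self] at h2
    exact h0 h2.symm
  -- Stone–Weierstrass: the set of `g` for which this holds is a closed subalgebra containing the
  -- identity function.
  have key : ∀ g : C(spectrum ℝ T, ℝ), cfcHom hT g v = (g ⟨μ, hμ⟩ : ℂ) • v := by
    intro g
    open scoped ContinuousFunctionalCalculus in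
    induction g using ContinuousMap.induction_on_of_compact with
    | const r =>
      have : cfcHom hT (ContinuousMap.const _ r) = algebraMap ℝ (H →L[ℂ] H) r :=
        AlgHomClass.commutes (cfcHom hT) r
      rw [this, Algebra.algebraMap_eq_smul_one]
      simp
    | id => rw [cfcHom_id hT]; exact hv
    | star_id => rw [map_star, cfcHom_id, hT.star_eq]; exact hv
    | add f g hf hg => rw [map_add, add_apply, hf, hg]; simp [add_smul]
    | mul f g hf hg =>
      rw [map_mul, ContinuousLinearMap.mul_def, ContinuousLinearMap.comp_apply, hg, map_smul, hf,
        smul_smul, ContinuousMap.mul_apply, Complex.ofReal_mul, mul_comm]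
    | frequently g hg =>
      have hcl : IsClosed {g : C(spectrum ℝ T, ℝ) | cfcHom hT g v = (g ⟨μ, hμ⟩ : ℂ) • v} := by
        refine isClosed_eq ?_ ?_
        · exact (ContinuousLinearMap.apply ℂ H v).continuous.comp (cfcHom_continuous hT)
        · exact (Complex.continuous_ofReal.comp (continuous_eval_const _)).smul
            continuous_const
      exact hcl.closure_subset_iff.mpr subset_rfl (mem_closure_iff_frequently.mpr hg)
  rw [cfc_apply f T hT hf.continuousOn, key]
  rfl

/-! ### Schmidt decomposition and the function `h` -/

section Schmidt

variable {A : QSystem.{u}} {B : QSystem.{v}}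

/-- The Schmidt decomposition of a vector, in terms of a Hilbert basis of eigenvectors of its
reduced density. -/
theorem exists_schmidt (φ : Tensor A B) :
    ∃ (ι : Type u) (_ : Countable ι) (e : HilbertBasis ι ℂ A) (p : ι → ℝ),
      (∀ i, reducedDensity φ (e i) = (p i : ℂ) • e i) ∧
      (∀ i, ‖contract (e i) φ‖ ^ 2 = p i) ∧
      Pairwise (fun i j => ⟪contract (e i) φ, contract (e j) φ⟫_ℂ = 0) ∧
      HasSum p (‖φ‖ ^ 2) := by
  obtain ⟨ι, e, p, he⟩ := exists_hilbertBasis_eigenvectors (isCompactOperator_reducedDensity φ)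
    (isSymmetric_reducedDensity φ)
  have hp : ∀ i, ‖contract (e i) φ‖ ^ 2 = p i := fun i => by
    have := inner_reducedDensity φ (e i) (e i)
    rw [he, inner_smul_right, inner_self_eq_norm_sq_to_K, inner_self_eq_norm_sq_to_K,
      e.orthonormal.1] at this
    have h2 : ((‖contract (e i) φ‖ ^ 2 : ℝ) : ℂ) = (p i : ℂ) := by
      push_cast
      simpa using this.symm
    exact_mod_cast h2
  refine ⟨ι, countable_of_orthonormal e.orthonormal, e, p, he, hp, fun i j hij => ?_, ?_⟩
  · change ⟪contract (e i) φ, contract (e j) φ⟫_ℂ = 0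
    rw [← inner_reducedDensity, he, inner_smul_right, e.orthonormal.2 hij.symm, mul_zero]
  · simpa only [hp] using hasSum_norm_contract_sq e φ

theorem hasSum_h {ι : Type*} {ρ : A →L[ℂ] A} (hρ : IsSelfAdjoint ρ) (e : HilbertBasis ι ℂ A)
    {p : ι → ℝ} (he : ∀ i, ρ (e i) = (p i : ℂ) • e i) (hp : ∀ i, 0 ≤ p i) (hs : Summable p)
    {x : ℝ} (hx : 0 < x) : HasSum (fun i => max (p i - x) 0) (h ρ x) := by
  classical
  set f : ℝ → ℝ := fun t => max (t - x) 0 with hf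
  -- The jump of the indicator is cancelled by the zero of `t - x`; the continuous form is what the
  -- functional calculus requires.
  have hfun : (fun t : ℝ => (t - x) * Set.indicator {s : ℝ | 0 ≤ s - x} 1 t) = f := by
    ext t
    by_cases ht : 0 ≤ t - x
    · rw [Set.indicator_of_mem (show t ∈ {s : ℝ | 0 ≤ s - x} from ht), hf]
      simp [ht]
    · rw [Set.indicator_of_notMem (show t ∉ {s : ℝ | 0 ≤ s - x} from ht), mul_zero, hf]
      exact (max_eq_right (not_le.mp ht).le).symm
  have hf0 : ∀ i, 0 ≤ f (p i) := fun i => le_max_right _ _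
  have hfs : Summable fun i => f (p i) :=
    Summable.of_nonneg_of_le hf0 (fun i => max_le (by linarith) (hp i)) hs
  have hv : ∀ i, ‖((Real.sqrt (f (p i)) : ℝ) : ℂ) • e i‖ ^ 2 = f (p i) := fun i => by
    rw [norm_smul, e.orthonormal.1, mul_one, Complex.norm_real, Real.norm_eq_abs, sq_abs,
      Real.sq_sqrt (hf0 i)]
  have hsum := (summable_pureState (v := fun i => ((Real.sqrt (f (p i)) : ℝ) : ℂ) • e i)
    (by simpa only [hv] using hfs)).hasSum
  have hcfc : cfc f ρ = ∑' i, pureState (((Real.sqrt (f (p i)) : ℝ) : ℂ) • e i) := by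
    refine clm_ext_hilbertBasis e fun k => ?_
    rw [cfc_apply_eigenvector hρ (by fun_prop) (he k)]
    have h1 := hsum.mapL (ContinuousLinearMap.apply ℂ A (e k))
    refine HasSum.unique ?_ h1
    have h2 : (f (p k) : ℂ) • e k = ContinuousLinearMap.apply ℂ A (e k)
        (pureState (((Real.sqrt (f (p k)) : ℝ) : ℂ) • e k)) := by
      simp only [pureState_smul, ContinuousLinearMap.apply_apply, smul_apply, pureState_apply,
        inner_self_eq_norm_sq_to_K, e.orthonormal.1]
      rw [Complex.norm_real, Real.norm_eq_abs, sq_abs, Real.sq_sqrt (hf0 k)]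
      simp
    rw [h2]
    refine hasSum_single k fun i hik => ?_
    simp only [pureState_smul, ContinuousLinearMap.apply_apply, smul_apply, pureState_apply,
      e.orthonormal.2 hik, zero_smul, smul_zero]
  have htr := trace_of_hasSum_pureState (by simpa only [hv] using hfs.hasSum) hsum
  rw [h, hfun, hcfc, htr, Complex.ofReal_re]
  exact hfs.hasSum

/-- `‖ρ‖` plays the role of the largest eigenvalue. Only finitely many `p i` reach `x / 2`, so if
all were below `x` they would have a bound `m < x`, and Parseval would give `‖ρ‖ ≤ m`. -/
theorem exists_le_eigenvalue {ι : Type*} {ρ : A →L[ℂ] A} (hρ : IsSelfAdjoint ρ)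
    (e : HilbertBasis ι ℂ A)
    {p : ι → ℝ} (he : ∀ i, ρ (e i) = (p i : ℂ) • e i) (hp : ∀ i, 0 ≤ p i) (hs : Summable p)
    {x : ℝ} (hx : 0 < x) (hx' : x ≤ ‖ρ‖) : ∃ i, x ≤ p i := by
  by_contra! hlt
  have hfin : {i | x / 2 ≤ p i}.Finite := by
    have := hs.tendsto_cofinite_zero.eventually (gt_mem_nhds (half_pos hx))
    rw [Filter.eventually_cofinite] at this
    simpa using this
  obtain ⟨m, hm0, hmx, hm⟩ : ∃ m, 0 ≤ m ∧ m < x ∧ ∀ i, p i ≤ m := by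
    rcases hfin.toFinset.eq_empty_or_nonempty with hE | hE
    · refine ⟨x / 2, by linarith, by linarith, fun i => ?_⟩
      by_contra! hi
      have : i ∈ hfin.toFinset := by simpa using hi.le
      simp [hE] at this
    · obtain ⟨k, hk, hmax⟩ := hfin.toFinset.exists_max_image p hE
      refine ⟨p k, hp k, hlt k, fun i => ?_⟩
      by_cases hi : x / 2 ≤ p i
      · exact hmax i (by simpa using hi)
      · exact (not_le.mp hi).le.trans (by simpa using hk)
  have hle : ‖ρ‖ ≤ m := by
    refine ContinuousLinearMap.opNorm_le_bound _ hm0 fun a => ?_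
    have h1 := hasSum_norm_inner_sq e (ρ a)
    have h2 := (hasSum_norm_inner_sq e a).mul_left (m ^ 2)
    have h3 : ‖ρ a‖ ^ 2 ≤ m ^ 2 * ‖a‖ ^ 2 := by
      refine hasSum_le (fun i => ?_) h1 h2
      rw [← ContinuousLinearMap.adjoint_inner_left, hρ.adjoint_eq, he, inner_smul_left, norm_mul,
        mul_pow]
      gcongr
      simpa [abs_of_nonneg (hp i)] using hm i
    rw [← mul_pow] at h3
    exact (pow_le_pow_iff_left₀ (norm_nonneg _) (by positivity) two_ne_zero).mp h3
  linarith

end Schmidt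

/-! ### Local measurements and Schmidt rank -/

section LocalMeasurement

variable {A A₁ : QSystem.{u}} {B B₁ : QSystem.{v}}

theorem adjoint_tensorRight_tprod (a : A) (b b' : B) :
    ContinuousLinearMap.adjoint (tensorRight A b) (tprod a b') = ⟪b, b'⟫_ℂ • a := by
  refine ext_inner_left ℂ fun a' => ?_
  rw [ContinuousLinearMap.adjoint_inner_right, tensorRight_apply, inner_tprod, inner_smul_right,
    mul_comm]

theorem adjoint_tensorRight_tensorOp (X : A →L[ℂ] A₁) (b : B) (φ : Tensor A B) :
    ContinuousLinearMap.adjoint (tensorRight A₁ b) (tensorOp X (ContinuousLinearMap.id ℂ B) φ) =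
      X (ContinuousLinearMap.adjoint (tensorRight A b) φ) := by
  have : ContinuousLinearMap.adjoint (tensorRight A₁ b) ∘L tensorOp X (ContinuousLinearMap.id ℂ B) =
      X ∘L ContinuousLinearMap.adjoint (tensorRight A b) :=
    clm_ext_tprod fun a b' => by
      simp only [ContinuousLinearMap.comp_apply]
      rw [tensorOp_tprod, adjoint_tensorRight_tprod, adjoint_tensorRight_tprod, map_smul]
      rfl
  exact congrArg (fun T => T φ) this

theorem contract_tensorOp (a : A) (Y : B →L[ℂ] B₁) (φ : Tensor A B) :
    contract a (tensorOp (ContinuousLinearMap.id ℂ A) Y φ) = Y (contract a φ) := by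
  have : ContinuousLinearMap.adjoint (tensorLeft B₁ a) ∘L
      tensorOp (ContinuousLinearMap.id ℂ A) Y =
      Y ∘L ContinuousLinearMap.adjoint (tensorLeft B a) :=
    clm_ext_tprod fun a' b => by
      simp only [ContinuousLinearMap.comp_apply]
      rw [tensorOp_tprod]
      change contract a (tprod a' (Y b)) = Y (contract a (tprod a' b))
      rw [contract_tprod, contract_tprod, map_smul]
  exact congrArg (fun T => T φ) this

/-- Completeness of `M` is applied to each component of `φ` along a basis of `B`, and the sums are
interchanged. -/
theorem hasSum_norm_tensorOp_left (M : Measurement A A₁) (φ : Tensor A B) :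
    HasSum (fun j => ‖tensorOp (M.K j) (ContinuousLinearMap.id ℂ B) φ‖ ^ 2) (‖φ‖ ^ 2) := by
  refine hasSum_comm_of_nonneg
    (f := fun i j => ‖M.K j (ContinuousLinearMap.adjoint (tensorRight A (basis B i)) φ)‖ ^ 2)
    (fun _ _ => by positivity) (fun i => M.complete _)
    (hasSum_norm_adjoint_tensorRight_sq (basis B) φ) fun j => ?_
  simp_rw [← adjoint_tensorRight_tensorOp]
  exact hasSum_norm_adjoint_tensorRight_sq (basis B) _

theorem hasSum_norm_tensorOp_right (M : Measurement B B₁) (φ : Tensor A B) :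
    HasSum (fun j => ‖tensorOp (ContinuousLinearMap.id ℂ A) (M.K j) φ‖ ^ 2) (‖φ‖ ^ 2) := by
  refine hasSum_comm_of_nonneg
    (f := fun i j => ‖M.K j (contract (basis A i) φ)‖ ^ 2)
    (fun _ _ => by positivity) (fun i => M.complete _)
    (hasSum_norm_contract_sq (basis A) φ) fun j => ?_
  simp_rw [← contract_tensorOp]
  exact hasSum_norm_contract_sq (basis A) _

/-- `φ` is a sum of `k` elementary tensors, that is, its Schmidt rank is at most `k`. -/
def SchmidtRankLE (k : ℕ) (φ : Tensor A B) : Prop :=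
  ∃ (a : Fin k → A) (b : Fin k → B), φ = ∑ i, tprod (a i) (b i)

theorem SchmidtRankLE.tensorOp {k : ℕ} {φ : Tensor A B} (hφ : SchmidtRankLE k φ)
    (X : A →L[ℂ] A₁) (Y : B →L[ℂ] B₁) : SchmidtRankLE k (tensorOp X Y φ) := by
  obtain ⟨a, b, rfl⟩ := hφ
  exact ⟨fun i => X (a i), fun i => Y (b i), by simp only [map_sum, tensorOp_tprod]⟩

end LocalMeasurement

/-! ### Branches of an LOCC protocol -/

/-- The branches of an LOCC protocol: every sequence of outcomes `w` acts by a Kraus operator `N w`,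
and the instrument is the sum over the sequences with the prescribed reported value. -/
structure Branches {A' : QSystem.{u}} {B' : QSystem.{v}} {A : QSystem.{u}} {B : QSystem.{v}}
    (I : Fin 2 → Op A B → Op A' B') (Ω : Type) where
  value : Ω → Fin 2
  N : Ω → Tensor A B →L[ℂ] Tensor A' B'
  schmidtRankLE : ∀ (w : Ω) (k : ℕ) (φ : Tensor A B),
    SchmidtRankLE k φ → SchmidtRankLE k (N w φ)
  complete : ∀ φ, HasSum (fun w => ‖N w φ‖ ^ 2) (‖φ‖ ^ 2)
  hasSum : ∀ i φ, HasSum (fun w => if i = value w then pureState (N w φ) else 0)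
    (I i (pureState φ))

/-- One more round, with Kraus operators `X j`, before given protocols. -/
def Branches.ofRound {A' A A₁ : QSystem.{u}} {B' B B₁ : QSystem.{v}}
    {I : ℕ → Fin 2 → Op A₁ B₁ → Op A' B'} {Ω : ℕ → Type} (D : ∀ j, Branches (I j) (Ω j))
    (X : ℕ → Tensor A B →L[ℂ] Tensor A₁ B₁)
    (hrank : ∀ (j k : ℕ) (φ : Tensor A B), SchmidtRankLE k φ → SchmidtRankLE k (X j φ))
    (hX : ∀ φ, HasSum (fun j => ‖X j φ‖ ^ 2) (‖φ‖ ^ 2)) :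
    Branches (fun i T => ∑' j, I j i ((X j ∘L T) ∘L ContinuousLinearMap.adjoint (X j)))
      (Σ j, Ω j) := by
  have hcomplete : ∀ φ, HasSum (fun w : (Σ j, Ω j) => ‖((D w.1).N w.2 ∘L X w.1) φ‖ ^ 2)
      (‖φ‖ ^ 2) := fun φ => by
    refine HasSum.sigma_of_hasSum (hX φ) (fun j => (D j).complete (X j φ)) ?_
    rw [summable_sigma_of_nonneg fun _ => by positivity]
    refine ⟨fun j => ((D j).complete (X j φ)).summable, ?_⟩
    refine (hX φ).summable.congr fun j => ?_
    exact ((D j).complete (X j φ)).tsum_eq.symm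
  refine
    { value := fun w => (D w.1).value w.2
      N := fun w => (D w.1).N w.2 ∘L X w.1
      schmidtRankLE := fun w k φ hφ => (D w.1).schmidtRankLE w.2 k _ (hrank w.1 k φ hφ)
      complete := hcomplete
      hasSum := fun i φ => ?_ }
  -- Since `‖pureState v‖ = ‖v‖²`, the sum over all outcome sequences converges absolutely and
  -- agrees with the nested series in the instrument.
  have hs : Summable fun w : (Σ j, Ω j) => if i = (D w.1).value w.2 then
      pureState (((D w.1).N w.2 ∘L X w.1) φ) else 0 := by
    refine Summable.of_norm_bounded (hcomplete φ).summable fun w => ?_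
    split_ifs
    · rw [norm_pureState]
    · rw [norm_zero]; positivity
  have h1 := hs.hasSum.sigma fun j => (D j).hasSum i (X j φ)
  simp_rw [comp_pureState_comp_adjoint]
  rw [h1.tsum_eq]
  exact hs.hasSum

/-- Induction on the rounds. The upper bound uses nothing else about LOCC than what `Branches`
records. -/
theorem LOCC.exists_branches {A' : QSystem.{u}} {B' : QSystem.{v}} {n : ℕ} {A : QSystem.{u}}
    {B : QSystem.{v}} (P : LOCC A' B' n A B) :
    ∃ Ω : Type, Nonempty (Branches P.instrument Ω) := by
  induction P with
  | finish value =>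
    refine ⟨Unit, ⟨⟨fun _ => value, fun _ => ContinuousLinearMap.id ℂ _, fun _ _ _ h => h,
      fun φ => ?_, fun i φ => ?_⟩⟩⟩
    · exact hasSum_unique (fun _ : Unit => ‖φ‖ ^ 2)
    · simp only [LOCC.instrument]
      exact hasSum_unique (fun _ : Unit => if i = value then pureState φ else 0)
  | alice A₁ M next ih =>
    choose Ω D using ih
    refine ⟨Σ j, Ω j, ⟨?_⟩⟩
    have := Branches.ofRound (fun j => (D j).some)
      (fun j => Entanglement.tensorOp (M.K j) (ContinuousLinearMap.id ℂ _))
      (fun j k φ h => h.tensorOp _ _) (fun φ => hasSum_norm_tensorOp_left M φ)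
    exact this
  | bob B₁ M next ih =>
    choose Ω D using ih
    refine ⟨Σ j, Ω j, ⟨?_⟩⟩
    have := Branches.ofRound (fun j => (D j).some)
      (fun j => Entanglement.tensorOp (ContinuousLinearMap.id ℂ _) (M.K j))
      (fun j k φ h => h.tensorOp _ _) (fun φ => hasSum_norm_tensorOp_right M φ)
    exact this

section Branches

variable {A A' : QSystem.{u}} {B B' : QSystem.{v}} {I : Fin 2 → Op A B → Op A' B'} {Ω : Type}

theorem Branches.summable_norm_sq (D : Branches I Ω) (i : Fin 2) (φ : Tensor A B) :
    Summable fun w => if i = D.value w then ‖D.N w φ‖ ^ 2 else 0 := by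
  refine Summable.of_nonneg_of_le (fun w => ?_) (fun w => ?_) (D.complete φ).summable
  · split_ifs <;> positivity
  · split_ifs
    · rfl
    · positivity

theorem Branches.trace_instrument (D : Branches I Ω) (i : Fin 2) (φ : Tensor A B) :
    trace (I i (pureState φ)) = ((∑' w, if i = D.value w then ‖D.N w φ‖ ^ 2 else 0 : ℝ) : ℂ) := by
  have hn : ∀ w, ‖(if i = D.value w then D.N w φ else 0)‖ ^ 2 =
      if i = D.value w then ‖D.N w φ‖ ^ 2 else 0 := fun w => by split_ifs <;> simp
  refine trace_of_hasSum_pureState (v := fun w => if i = D.value w then D.N w φ else 0) ?_ ?_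
  · simp_rw [hn]
    exact (D.summable_norm_sq i φ).hasSum
  · convert! D.hasSum i φ using 2 with w
    split_ifs
    · rfl
    · exact pureState_zero

theorem Branches.trace_add_trace (D : Branches I Ω) (φ : Tensor A B) :
    (trace (I 0 (pureState φ))).re + (trace (I 1 (pureState φ))).re = ‖φ‖ ^ 2 := by
  rw [D.trace_instrument, D.trace_instrument, Complex.ofReal_re, Complex.ofReal_re]
  rw [← (D.summable_norm_sq 0 φ).tsum_add (D.summable_norm_sq 1 φ), ← (D.complete φ).tsum_eq]
  congr 1
  ext w
  rcases Fin.exists_fin_two.mp ⟨D.value w, rfl⟩ with h | h <;> simp [h]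

end Branches

/-! ### The upper bound -/

section Converse

variable {A : QSystem.{u}} {B : QSystem.{v}}

/-- Pythagoras: the sum is the orthogonal projection of `φ` onto `span (v i) ⊗ B`. -/
theorem norm_sub_sum_tprod_contract_sq {ι : Type*} {v : ι → A} (hv : Orthonormal ℂ v)
    (s : Finset ι) (φ : Tensor A B) :
    ‖φ - ∑ i ∈ s, tprod (v i) (contract (v i) φ)‖ ^ 2 =
      ‖φ‖ ^ 2 - ∑ i ∈ s, ‖contract (v i) φ‖ ^ 2 := by
  classical
  set χ := ∑ i ∈ s, tprod (v i) (contract (v i) φ) with hχ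
  have h1 : ⟪χ, φ⟫_ℂ = ((∑ i ∈ s, ‖contract (v i) φ‖ ^ 2 : ℝ) : ℂ) := by
    rw [hχ, sum_inner]
    push_cast
    refine Finset.sum_congr rfl fun i _ => ?_
    rw [← inner_contract_right, inner_self_eq_norm_sq_to_K]
    rfl
  have h2 : ⟪χ, χ⟫_ℂ = ((∑ i ∈ s, ‖contract (v i) φ‖ ^ 2 : ℝ) : ℂ) := by
    rw [hχ, sum_inner]
    push_cast
    refine Finset.sum_congr rfl fun i hi => ?_
    rw [inner_sum, Finset.sum_eq_single_of_mem i hi]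
    · rw [inner_tprod, inner_self_eq_norm_sq_to_K, inner_self_eq_norm_sq_to_K, hv.1]
      simp
    · intro j _ hji
      rw [inner_tprod, hv.2 hji.symm, zero_mul]
  have h3 : ‖χ‖ ^ 2 = ∑ i ∈ s, ‖contract (v i) φ‖ ^ 2 := by
    rw [inner_self_eq_norm_sq_to_K] at h2
    refine Complex.ofReal_injective (Eq.trans ?_ h2)
    push_cast
    rfl
  rw [norm_sub_rev, @norm_sub_sq ℂ, h1, h3]
  simp only [RCLike.re_eq_complex_re, Complex.ofReal_re]
  ring

/-- The left side is `⟪a, ρ a⟫`, and `ρ` is a projection divided by `L`. -/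
theorem norm_contract_sq_le {Ψ : Tensor A B} {L : ℕ} (hΨ : IsMaximallyEntangled Ψ L) {a : A}
    (ha : ‖a‖ = 1) : ‖contract a Ψ‖ ^ 2 ≤ (L : ℝ)⁻¹ := by
  obtain ⟨-, V, hV, -, hρ⟩ := hΨ
  have h1 := inner_reducedDensity Ψ a a
  rw [hρ, smul_apply, inner_smul_right, inner_self_eq_norm_sq_to_K] at h1
  have h2 : ‖contract a Ψ‖ ^ 2 = (L : ℝ)⁻¹ * ‖⟪a, V.starProjection a⟫_ℂ‖ := by
    have := congrArg norm h1
    simpa using this.symm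
  rw [h2]
  refine mul_le_of_le_one_right (by positivity) ?_
  calc ‖⟪a, V.starProjection a⟫_ℂ‖ ≤ ‖a‖ * ‖V.starProjection a‖ := norm_inner_le_norm _ _
    _ ≤ ‖a‖ * ‖a‖ := by gcongr; exact V.norm_starProjection_apply_le a
    _ = 1 := by simp [ha]

/-- A maximally entangled state of size `L` is far from all vectors of Schmidt rank `k < L`. -/
theorem IsMaximallyEntangled.le_norm_sub_sq {Ψ χ : Tensor A B} {L k : ℕ}
    (hΨ : IsMaximallyEntangled Ψ L) (hχ : SchmidtRankLE k χ) (c : ℂ) :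
    ‖c • Ψ‖ ^ 2 * (1 - k / L) ≤ ‖c • Ψ - χ‖ ^ 2 := by
  obtain ⟨a, b, rfl⟩ := hχ
  set χ := ∑ i, tprod (a i) (b i) with hχ
  set V : Submodule ℂ A := Submodule.span ℂ (Set.range a) with hVdef
  have hcard : Module.finrank ℂ V ≤ k := 
    (finrank_range_le_card (R := ℂ) a).trans (Fintype.card_fin k).le
  have hfd : FiniteDimensional ℂ V := FiniteDimensional.span_of_finite ℂ (Set.finite_range a)
  let o := stdOrthonormalBasis ℂ V
  have hv : Orthonormal ℂ (fun l => (o l : A)) := o.orthonormal.comp_linearIsometry V.subtypeₗᵢ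
  -- `R` projects onto `V ⊗ B`. It fixes `χ`, so the distance is at least the norm of the part of `c
  -- • Ψ` outside `V ⊗ B`.
  let R : Tensor A B → Tensor A B := fun φ => ∑ l, tprod (o l : A) (contract (o l : A) φ)
  have hadd : ∀ φ φ', R (φ - φ') = R φ - R φ' := fun φ φ' => by
    simp only [R, ← Finset.sum_sub_distrib, contract, map_sub, ← tensorLeft_apply]
  have hRχ : R χ = χ := by
    simp only [R, hχ, contract, map_sum, ← tensorLeft_apply]
    rw [Finset.sum_comm]
    refine Finset.sum_congr rfl fun i _ => ?_
    have ha : a i ∈ V := Submodule.subset_span ⟨i, rfl⟩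
    have h1 : a i = ∑ l, ⟪(o l : A), a i⟫_ℂ • (o l : A) := by
      have := congrArg Subtype.val (o.sum_repr' ⟨a i, ha⟩)
      simpa using this.symm
    conv_rhs => rw [h1, tensorLeft_apply, ← tensorRight_apply, map_sum]
    refine Finset.sum_congr rfl fun l _ => ?_
    have h2 := contract_tprod (o l : A) (a i) (b i)
    rw [contract, ← tensorLeft_apply] at h2
    rw [h2, map_smul, map_smul, tensorLeft_apply, tensorRight_apply]
  have hY := norm_sub_sum_tprod_contract_sq hv Finset.univ (c • Ψ - χ)
  have hΨ' := norm_sub_sum_tprod_contract_sq hv Finset.univ (c • Ψ)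
  have heq : (c • Ψ - χ) - R (c • Ψ - χ) = c • Ψ - R (c • Ψ) := by
    rw [hadd, hRχ]; abel
  change ‖(c • Ψ - χ) - R (c • Ψ - χ)‖ ^ 2 = _ at hY
  change ‖c • Ψ - R (c • Ψ)‖ ^ 2 = _ at hΨ'
  rw [heq, hΨ'] at hY
  have hle : ∑ l, ‖contract (o l : A) (c • Ψ)‖ ^ 2 ≤ ‖c • Ψ‖ ^ 2 * (k / L) := by
    have hc : ∀ l, ‖contract (o l : A) (c • Ψ)‖ ^ 2 ≤ ‖c • Ψ‖ ^ 2 * (L : ℝ)⁻¹ := fun l => by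
      rw [contract, map_smul, norm_smul, norm_smul, hΨ.1, mul_one, mul_pow]
      gcongr
      exact norm_contract_sq_le hΨ (hv.1 l)
    calc ∑ l, ‖contract (o l : A) (c • Ψ)‖ ^ 2
        ≤ ∑ _l : Fin (Module.finrank ℂ V), ‖c • Ψ‖ ^ 2 * (L : ℝ)⁻¹ :=
          Finset.sum_le_sum fun l _ => hc l
      _ = (Module.finrank ℂ V : ℝ) * (‖c • Ψ‖ ^ 2 * (L : ℝ)⁻¹) := by simp
      _ ≤ (k : ℝ) * (‖c • Ψ‖ ^ 2 * (L : ℝ)⁻¹) := by gcongr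
      _ = ‖c • Ψ‖ ^ 2 * (k / L) := by ring
  have hnn : 0 ≤ ∑ l, ‖contract (o l : A) (c • Ψ - χ)‖ ^ 2 :=
    Finset.sum_nonneg fun _ _ => by positivity
  rw [mul_sub, mul_one]
  linarith

/-- If a sum of pure states is a multiple of the pure state `Ψ`, every summand is. -/
theorem eq_smul_of_hasSum_pureState {H ι : Type*} [NormedAddCommGroup H] [InnerProductSpace ℂ H]
    {v : ι → H} {Ψ : H} (hΨ : ‖Ψ‖ = 1) {s : ℂ}
    (hs : HasSum (fun i => pureState (v i)) (s • pureState Ψ)) (i : ι) : ∃ c : ℂ, v i = c • Ψ := by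
  -- `r` is the part of `v i` orthogonal to `Ψ`. Taking the expectation of the sum at `r` gives `∑
  -- |⟪r, v j⟫|² = 0`, hence `r = 0`.
  set r := v i - ⟪Ψ, v i⟫_ℂ • Ψ with hr
  have horth : ⟪Ψ, r⟫_ℂ = 0 := by
    rw [hr, inner_sub_right, inner_smul_right, inner_self_eq_norm_sq_to_K, hΨ]
    simp
  have h1 := (hs.mapL (ContinuousLinearMap.apply ℂ H r)).mapL (innerSL ℂ r)
  simp only [ContinuousLinearMap.apply_apply, innerSL_apply_apply, inner_pureState_self, smul_apply,
    pureState_apply Ψ, horth, zero_smul, smul_zero, inner_zero_right] at h1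
  have h2 : HasSum (fun j => ‖⟪r, v j⟫_ℂ‖ ^ 2) (0 : ℝ) :=
    Complex.hasSum_ofReal.mp (by rwa [Complex.ofReal_zero])
  have h3 := congrFun ((hasSum_zero_iff_of_nonneg fun j => by positivity).mp h2) i
  have h4 : ⟪r, v i⟫_ℂ = 0 := by simpa using h3
  have h5 : ⟪r, r⟫_ℂ = 0 := by
    have hro : ⟪r, Ψ⟫_ℂ = 0 := by rw [← inner_conj_symm, horth, map_zero]
    conv_lhs => rw [hr, inner_sub_right, ← hr, h4, inner_smul_right, hro]
    simp
  exact ⟨⟪Ψ, v i⟫_ℂ, sub_eq_zero.mp (inner_self_eq_zero.mp h5)⟩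

/-- Each successful branch contributes its weight times `1 - k/L` to the left side, which is bounded
by its share of `‖Φ - χ‖²`; the failing branches only enlarge the right side. -/
theorem IsPFLEC.success_mul_le {n : ℕ} {P : LOCC A B n A B} {Φ : Tensor A B} {L k : ℕ}
    (hP : IsPFLEC P Φ L) {χ : Tensor A B} (hχ : SchmidtRankLE k χ) :
    (trace (P.instrument 1 (pureState Φ))).re * (1 - k / L) ≤ ‖Φ - χ‖ ^ 2 := by
  obtain ⟨Ψ, hΨ, hI⟩ := hP
  obtain ⟨Ω, ⟨D⟩⟩ := P.exists_branches
  set s := trace (P.instrument 1 (pureState Φ)) with hs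
  -- With trace zero, `0⁻¹ = 0` would make the normalized state zero.
  have hs0 : s ≠ 0 := by
    intro h0
    rw [h0, inv_zero, zero_smul] at hI
    have := norm_pureState Ψ
    rw [← hI, hΨ.1] at this
    simp at this
  have hI' : P.instrument 1 (pureState Φ) = s • pureState Ψ := by
    rw [← hI, smul_smul, mul_inv_cancel₀ hs0, one_smul]
  have hsum := D.hasSum 1 Φ
  rw [hI'] at hsum
  have hbr : ∀ w, 1 = D.value w → ∃ c : ℂ, D.N w Φ = c • Ψ := fun w hw => by
    have hsum' : HasSum (fun w => pureState (if 1 = D.value w then D.N w Φ else 0))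
        (s • pureState Ψ) := by
      convert! hsum using 2 with w
      split_ifs
      · rfl
      · exact pureState_zero
    simpa [← hw] using eq_smul_of_hasSum_pureState hΨ.1 hsum' w
  have hre : s.re = ∑' w, if 1 = D.value w then ‖D.N w Φ‖ ^ 2 else 0 := by
    rw [hs, D.trace_instrument, Complex.ofReal_re]
  have hsm : Summable fun w => if 1 = D.value w then ‖D.N w Φ‖ ^ 2 else 0 := D.summable_norm_sq 1 Φ
  rw [hre]
  refine hasSum_le (fun w => ?_) (hsm.hasSum.mul_right _) (D.complete (Φ - χ))
  split_ifs with hw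
  · obtain ⟨c, hc⟩ := hbr w hw
    rw [map_sub, hc]
    exact hΨ.le_norm_sub_sq (D.schmidtRankLE w k χ hχ) c
  · rw [zero_mul]; positivity

theorem isSelfAdjoint_reducedDensity (φ : Tensor A B) : IsSelfAdjoint (reducedDensity φ) :=
  ContinuousLinearMap.isSelfAdjoint_iff_isSymmetric.mpr (isSymmetric_reducedDensity φ)

/-- The size of the final state of an entanglement concentration is bounded in terms of the failure
probability. -/
theorem IsPFLEC.size_mul_le {n : ℕ} {P : LOCC A B n A B} {Φ : Tensor A B} (hΦ : ‖Φ‖ = 1) {L : ℕ}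
    (hP : IsPFLEC P Φ L) {x : ℝ} (hx : 0 < x) (hx' : x ≤ ‖reducedDensity Φ‖)
    (hfail : failureProb P Φ ≤ h (reducedDensity Φ) x) : L * x ≤ 1 - h (reducedDensity Φ) x := by
  classical
  obtain ⟨ι, -, e, p, he, hp, -, hsum⟩ := exists_schmidt Φ
  rw [hΦ, one_pow] at hsum
  have hp0 : ∀ i, 0 ≤ p i := fun i => hp i ▸ by positivity
  have hρ := isSelfAdjoint_reducedDensity Φ
  have hh := hasSum_h hρ e he hp0 hsum.summable hx
  obtain ⟨i₀, hi₀⟩ := exists_le_eigenvalue hρ e he hp0 hsum.summable hx hx'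
  have hfin : {i | x ≤ p i}.Finite := by
    have := hsum.summable.tendsto_cofinite_zero.eventually (gt_mem_nhds hx)
    rw [Filter.eventually_cofinite] at this
    simpa using this
  set T := hfin.toFinset with hT
  have hmem : ∀ i, i ∈ T ↔ x ≤ p i := fun i => by simp [hT]
  set k := T.card with hk
  -- Here `x ≤ ‖ρ‖` enters; `k` is cancelled at the end.
  have hk1 : (1 : ℝ) ≤ k := by exact_mod_cast Finset.card_pos.mpr ⟨i₀, (hmem i₀).mpr hi₀⟩
  set χ := ∑ i ∈ T, tprod (e i) (contract (e i) Φ) with hχdef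
  have hχ : SchmidtRankLE k χ := by
    refine ⟨fun l => e (T.equivFin.symm l), fun l => contract (e (T.equivFin.symm l)) Φ, ?_⟩
    rw [hχdef, ← Finset.sum_coe_sort T fun i => tprod (e i) (contract (e i) Φ)]
    exact (Equiv.sum_comp T.equivFin.symm fun i : T => tprod (e i) (contract (e i) Φ)).symm
  have hh' : h (reducedDensity Φ) x = ∑ i ∈ T, p i - k * x := by
    have h1 : HasSum (fun i => max (p i - x) 0) (∑ i ∈ T, max (p i - x) 0) :=
      hasSum_sum_of_ne_finset_zero fun i hi => by
        rw [hmem, not_le] at hi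
        exact max_eq_right (by linarith)
    rw [hh.unique h1, Finset.sum_congr rfl fun i hi =>
      max_eq_left (sub_nonneg.mpr ((hmem i).mp hi)), Finset.sum_sub_distrib]
    simp [hk]
  have hdist : ‖Φ - χ‖ ^ 2 = 1 - h (reducedDensity Φ) x - k * x := by
    rw [hχdef, norm_sub_sum_tprod_contract_sq e.orthonormal, hΦ, hh']
    simp only [hp]
    ring
  have hmain := hP.success_mul_le hχ
  obtain ⟨Ω, ⟨D⟩⟩ := P.exists_branches
  have htot := D.trace_add_trace Φ
  rw [hΦ, one_pow] at htot
  rw [failureProb] at hfail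
  rw [hdist] at hmain
  set hx0 := h (reducedDensity Φ) x
  set s := (trace (P.instrument 1 (pureState Φ))).re
  -- For `L ≤ k` the bound is just `0 ≤ ‖Φ - χ‖²`; the rank estimate says something only for `L >
  -- k`.
  rcases le_or_gt L k with hLk | hLk
  · have h1 : 0 ≤ 1 - hx0 - k * x := hdist ▸ by positivity
    have h2 : (L : ℝ) * x ≤ k * x := by gcongr
    linarith
  · have hL : (0 : ℝ) < L := by exact_mod_cast (Nat.zero_le k).trans_lt hLk
    have h1 : (0 : ℝ) ≤ 1 - k / L := by
      rw [sub_nonneg, div_le_one hL]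
      exact_mod_cast hLk.le
    have h2 : (1 - hx0) * (1 - k / L) ≤ 1 - hx0 - k * x :=
      (mul_le_mul_of_nonneg_right (by linarith) h1).trans hmain
    have h3 : (k : ℝ) * x ≤ k * ((1 - hx0) / L) := by
      have : (1 - hx0) * (k / L) = k * ((1 - hx0) / L) := by ring
      linarith
    have h4 : x ≤ (1 - hx0) / L := le_of_mul_le_mul_left h3 (by linarith)
    rw [le_div_iff₀ hL] at h4
    linarith

end Converse

/-! ### Systematic sampling -/

section Sampling

open MeasureTheory

theorem ceil_sub_eq (b : ℝ) {u : ℝ} (hu : u ∈ Set.Ioo (0 : ℝ) 1) :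
    (⌈b - u⌉ : ℝ) = ⌊b⌋ + Set.indicator (Set.Ioo 0 (Int.fract b)) 1 u := by
  have h1 := Int.floor_add_fract b
  have h2 := Int.fract_nonneg b
  have h3 := Int.fract_lt_one b
  by_cases hf : u < Int.fract b
  · rw [Set.indicator_of_mem (show u ∈ Set.Ioo 0 (Int.fract b) from ⟨hu.1, hf⟩)]
    have : ⌈b - u⌉ = ⌊b⌋ + 1 := by
      rw [Int.ceil_eq_iff]
      push_cast
      constructor <;> linarith [hu.1]
    rw [this]; simp
  · rw [Set.indicator_of_notMem (fun h => hf h.2)]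
    have : ⌈b - u⌉ = ⌊b⌋ := by
      rw [Int.ceil_eq_iff]
      constructor <;> linarith [hu.2]
    rw [this]; simp

theorem integrableOn_indicator_Ioo (b : ℝ) : IntegrableOn
    (Set.indicator (Set.Ioo 0 (Int.fract b)) (1 : ℝ → ℝ)) (Set.Ioo (0 : ℝ) 1) :=
  IntegrableOn.indicator (integrableOn_const (by simp)) measurableSet_Ioo

theorem integrableOn_ceil_sub (b : ℝ) :
    IntegrableOn (fun u : ℝ => (⌈b - u⌉ : ℝ)) (Set.Ioo (0 : ℝ) 1) := by
  have h : IntegrableOn (fun u => (⌊b⌋ : ℝ) + Set.indicator (Set.Ioo 0 (Int.fract b)) 1 u)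
      (Set.Ioo (0 : ℝ) 1) :=
    (integrableOn_const (by simp)).add (integrableOn_indicator_Ioo b)
  exact h.congr_fun (fun u hu => (ceil_sub_eq b hu).symm) measurableSet_Ioo

/-- Rounding with a uniform random offset is unbiased: it rounds up with probability `Int.fract b`.
-/
theorem setIntegral_ceil_sub (b : ℝ) : ∫ u in Set.Ioo (0 : ℝ) 1, (⌈b - u⌉ : ℝ) = b := by
  rw [setIntegral_congr_fun measurableSet_Ioo fun u hu => ceil_sub_eq b hu,
    integral_add (integrable_const _) (integrableOn_indicator_Ioo b),
    setIntegral_indicator measurableSet_Ioo, Set.inter_eq_right.mpr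
      (Set.Ioo_subset_Ioo_right (Int.fract_lt_one b).le)]
  simp [Int.fract_nonneg]

/-- The difference of the values of `⌈· - u⌉` at two points at distance at most one is zero or
one. -/
theorem ceil_sub_sub_ceil_sub {a b : ℝ} (hab : a ≤ b) (hb : b ≤ a + 1) (u : ℝ) :
    (⌈b - u⌉ - ⌈a - u⌉ : ℤ) = if ⌈b - u⌉ ≠ ⌈a - u⌉ then 1 else 0 := by
  have h1 : ⌈a - u⌉ ≤ ⌈b - u⌉ := Int.ceil_mono (by linarith)
  have h2 : ⌈b - u⌉ ≤ ⌈a - u⌉ + 1 := by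
    rw [← Int.ceil_add_one]
    exact Int.ceil_mono (by linarith)
  split_ifs with h <;> omega

theorem measurableSet_ceil_ne (a b : ℝ) : MeasurableSet {u : ℝ | ⌈b - u⌉ ≠ ⌈a - u⌉} :=
  (measurableSet_eq_fun (Int.measurable_ceil.comp (measurable_const.sub measurable_id))
    (Int.measurable_ceil.comp (measurable_const.sub measurable_id))).compl

/-- The rounded values differ by the indicator of this event, so its probability is the difference
of their means. -/
theorem volume_ceil_ne {a b : ℝ} (hab : a ≤ b) (hb : b ≤ a + 1) :
    volume.real ({u : ℝ | ⌈b - u⌉ ≠ ⌈a - u⌉} ∩ Set.Ioo 0 1) = b - a := by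
  have h1 : ∀ u : ℝ, (⌈b - u⌉ : ℝ) - ⌈a - u⌉ =
      Set.indicator {u : ℝ | ⌈b - u⌉ ≠ ⌈a - u⌉} 1 u := fun u => by
    have := congrArg (Int.cast : ℤ → ℝ) (ceil_sub_sub_ceil_sub hab hb u)
    push_cast at this
    rw [this, Set.indicator_apply]
    rfl
  have h2 := integral_sub (integrableOn_ceil_sub b) (integrableOn_ceil_sub a)
  rw [setIntegral_ceil_sub, setIntegral_ceil_sub] at h2
  simp_rw [h1] at h2
  rw [← h2, integral_indicator_one (measurableSet_ceil_ne a b),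
    measureReal_restrict_apply (measurableSet_ceil_ne a b)]

theorem hasSum_measureReal_iUnion {α κ : Type*} [MeasurableSpace α] [Countable κ] {μ : Measure α}
    {E : κ → Set α} (hm : ∀ k, MeasurableSet (E k)) (hd : Pairwise (Function.onFun Disjoint E))
    (hfin : μ (⋃ k, E k) ≠ ⊤) : HasSum (fun k => μ.real (E k)) (μ.real (⋃ k, E k)) := by
  have h1 := measure_iUnion (μ := μ) hd hm
  rw [h1] at hfin
  convert! ENNReal.hasSum_toReal hfin using 1
  rw [measureReal_def, h1, ENNReal.tsum_toReal_eq (ENNReal.ne_top_of_tsum_ne_top hfin)]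

/-- Systematic sampling: a sequence of inclusion probabilities with sum `L` is realized by a random
set with exactly `L` elements. -/
theorem exists_sampling_nat {q : ℕ → ℝ} (h0 : ∀ i, 0 ≤ q i) (h1 : ∀ i, q i ≤ 1) {L : ℕ}
    (hq : HasSum q L) : ∃ w : Finset ℕ → ℝ, (∀ S, 0 ≤ w S) ∧ HasSum w 1 ∧
      (∀ S, w S ≠ 0 → S.card = L) ∧ ∀ i, HasSum (fun S => if i ∈ S then w S else 0) (q i) := by
  set C : ℕ → ℝ := fun n => ∑ k ∈ Finset.range n, q k with hC
  have hC0 : C 0 = 0 := by simp [hC]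
  have hCs : ∀ n, C (n + 1) = C n + q n := fun n => by simp [hC, Finset.sum_range_succ]
  have hmono : ∀ n, C n ≤ C (n + 1) := fun n => by rw [hCs]; linarith [h0 n]
  have hstep : ∀ n, C (n + 1) ≤ C n + 1 := fun n => by rw [hCs]; linarith [h1 n]
  have hCL : ∀ n, C n ≤ L := fun n => sum_le_hasSum _ (fun i _ => h0 i) hq
  -- With the intervals `[C i, C (i + 1))` of length `q i` laid end to end, `i` is selected when a
  -- point of `u + ℤ` falls into its interval.
  set G : ℕ → Set ℝ := fun i => {u : ℝ | ⌈C (i + 1) - u⌉ ≠ ⌈C i - u⌉} with hG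
  have hGm : ∀ i, MeasurableSet (G i) := fun i => measurableSet_ceil_ne _ _
  set E : Finset ℕ → Set ℝ := fun S => {u | ∀ i, u ∈ G i ↔ i ∈ S} ∩ Set.Ioo 0 1 with hE
  have hEm : ∀ S, MeasurableSet (E S) := fun S => by
    refine MeasurableSet.inter ?_ measurableSet_Ioo
    rw [show {u | ∀ i, u ∈ G i ↔ i ∈ S} = ⋂ i, {u | u ∈ G i ↔ i ∈ S} by ext; simp]
    exact MeasurableSet.iInter fun i => (hGm i).iff (MeasurableSet.const _)
  have huniq : ∀ {S S' u}, u ∈ E S → u ∈ E S' → S = S' := fun {S S' u} hS hS' => by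
    ext i
    rw [← hS.1 i, ← hS'.1 i]
  have hdisj : Pairwise (Function.onFun Disjoint E) := fun S S' hne =>
    Set.disjoint_left.mpr fun u hS hS' => hne (huniq hS hS')
  have hex : ∀ u ∈ Set.Ioo (0 : ℝ) 1, ∃ S, u ∈ E S ∧ S.card = L := by
    intro u hu
    -- `C n` increases to `L` and `0 < u < 1`, so `C n - u` ends up in `(L - 1, L]`. Hence the
    -- selection is finite, and its size telescopes to `L`.
    have hev : ∀ᶠ n in Filter.atTop, ⌈C n - u⌉ = L := by
      have hlim := hq.tendsto_sum_nat.eventually (lt_mem_nhds (show (L : ℝ) - (1 - u) < L by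
        linarith [hu.2]))
      filter_upwards [hlim] with n hn
      rw [Int.ceil_eq_iff]
      push_cast
      exact ⟨by simp only [hC]; linarith, by linarith [hCL n, hu.1]⟩
    obtain ⟨N, hN⟩ := Filter.eventually_atTop.mp hev
    classical
    refine ⟨{i ∈ Finset.range N | u ∈ G i}, ⟨fun i => ?_, hu⟩, ?_⟩
    · rw [Finset.mem_filter, Finset.mem_range]
      refine ⟨fun hi => ⟨?_, hi⟩, fun hi => hi.2⟩
      by_contra! hle
      exact hi (by rw [hN _ hle, hN _ (hle.trans (Nat.le_succ i))])
    · have hsum : ((Finset.card {i ∈ Finset.range N | u ∈ G i} : ℕ) : ℤ) = L := by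
        rw [Finset.card_filter]
        push_cast
        calc ∑ i ∈ Finset.range N, (if u ∈ G i then (1 : ℤ) else 0)
            = ∑ i ∈ Finset.range N, (⌈C (i + 1) - u⌉ - ⌈C i - u⌉) :=
              Finset.sum_congr rfl fun i _ => by
                rw [ceil_sub_sub_ceil_sub (hmono i) (hstep i) u]
                rfl
          _ = ⌈C N - u⌉ - ⌈C 0 - u⌉ := Finset.sum_range_sub (fun i => ⌈C i - u⌉) N
          _ = L := by
              have h00 : ⌈C 0 - u⌉ = 0 := by
                rw [Int.ceil_eq_iff, hC0]
                push_cast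
                constructor <;> linarith [hu.1, hu.2]
              rw [hN N le_rfl, h00, sub_zero]
      exact_mod_cast hsum
  have hfinite : ∀ T : Set ℝ, volume (T ∩ Set.Ioo 0 1) ≠ ⊤ := fun T =>
    measure_ne_top_of_subset Set.inter_subset_right (by simp)
  refine ⟨fun S => volume.real (E S), fun S => measureReal_nonneg, ?_, fun S hS => ?_, fun i => ?_⟩
  · have hU : ⋃ S, E S = Set.Ioo 0 1 := by
      ext u
      refine ⟨fun hu => ?_, fun hu => ?_⟩
      · obtain ⟨S, hS⟩ := Set.mem_iUnion.mp hu
        exact hS.2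
      · obtain ⟨S, hS, -⟩ := hex u hu
        exact Set.mem_iUnion.mpr ⟨S, hS⟩
    have h2 := hasSum_measureReal_iUnion hEm hdisj (μ := volume) (by rw [hU]; simp)
    rw [hU] at h2
    simpa using h2
  · obtain ⟨u, hu⟩ : (E S).Nonempty := by
      rw [Set.nonempty_iff_ne_empty]
      intro he
      exact hS (by simp [he])
    obtain ⟨S', hS', hc⟩ := hex u hu.2
    rwa [huniq hu hS']
  · have hU : ⋃ S, (if i ∈ S then E S else ∅) = G i ∩ Set.Ioo 0 1 := by
      ext u
      refine ⟨fun hu => ?_, fun hu => ?_⟩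
      · obtain ⟨S, hS⟩ := Set.mem_iUnion.mp hu
        split_ifs at hS with hi
        · exact ⟨(hS.1 i).mpr hi, hS.2⟩
        · exact hS.elim
      · obtain ⟨S, hS, -⟩ := hex u hu.2
        exact Set.mem_iUnion.mpr ⟨S, by rwa [if_pos ((hS.1 i).mp hu.1)]⟩
    have h2 := hasSum_measureReal_iUnion (μ := volume) (E := fun S => if i ∈ S then E S else ∅)
      (fun S => by split_ifs; exacts [hEm S, MeasurableSet.empty])
      (fun S S' hne => by
        simp only [Function.onFun]
        split_ifs
        exacts [hdisj hne, disjoint_bot_right, disjoint_bot_left, disjoint_bot_left])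
      (by rw [hU]; exact hfinite _)
    rw [hU, volume_ceil_ne (hmono i) (hstep i), hCs, add_sub_cancel_left] at h2
    convert! h2 using 2 with S
    split_ifs <;> simp

/-- A family of inclusion probabilities with sum `L` is a countable mixture of the indicator
functions of sets with `L` elements. -/
theorem exists_sampling {ι : Type*} [Countable ι] [DecidableEq ι] {q : ι → ℝ} (h0 : ∀ i, 0 ≤ q i)
    (h1 : ∀ i, q i ≤ 1) {L : ℕ} (hq : HasSum q L) :
    ∃ (w : ℕ → ℝ) (S : ℕ → Finset ι), (∀ j, 0 ≤ w j) ∧ HasSum w 1 ∧ (∀ j, (S j).card = L) ∧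
      (∀ j, ∀ i ∈ S j, 0 < q i) ∧ ∀ i, HasSum (fun j => if i ∈ S j then w j else 0) (q i) := by
  classical
  obtain ⟨g, hg⟩ := exists_injective_nat ι
  obtain ⟨w, hw0, hw1, hwL, hwq⟩ := exists_sampling_nat (q := Function.extend g q 0)
    (fun n => by
      by_cases hn : ∃ i, g i = n
      · obtain ⟨i, rfl⟩ := hn
        rw [hg.extend_apply]; exact h0 i
      · rw [Function.extend_apply' _ _ _ hn]; rfl)
    (fun n => by
      by_cases hn : ∃ i, g i = n
      · obtain ⟨i, rfl⟩ := hn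
        rw [hg.extend_apply]; exact h1 i
      · rw [Function.extend_apply' _ _ _ hn]; exact zero_le_one)
    ((hasSum_extend_zero hg).mpr hq)
  let ε := (Denumerable.eqv (Finset ℕ)).symm
  -- The weight of one set is at most the inclusion probability of each of its elements. In
  -- particular, sets of nonzero weight lie in the range of `g`.
  have hpos : ∀ S n, w S ≠ 0 → n ∈ S → 0 < Function.extend g q 0 n := fun S n hS hn => by
    have h2 := le_hasSum (hwq n) S fun S' _ => by split_ifs; exacts [hw0 S', le_rfl]
    rw [if_pos hn] at h2
    exact (lt_of_le_of_ne (hw0 S) hS.symm).trans_le h2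
  let S₁ : ℕ → Finset ι := fun j => (ε j).preimage g hg.injOn
  have hcard : ∀ j, w (ε j) ≠ 0 → (S₁ j).card = L := fun j hj => by
    rw [← hwL _ hj, Finset.card_preimage]
    congr 1
    refine Finset.filter_true_of_mem fun n hn => ?_
    by_contra hr
    have := hpos _ n hj hn
    rw [Function.extend_apply' _ _ _ hr] at this
    exact lt_irrefl _ this
  have hpos₁ : ∀ j, w (ε j) ≠ 0 → ∀ i ∈ S₁ j, 0 < q i := fun j hj i hi => by
    have := hpos _ _ hj (Finset.mem_preimage.mp hi)
    rwa [hg.extend_apply] at this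
  have hsum : HasSum (fun j => w (ε j)) 1 := ε.hasSum_iff.mpr hw1
  obtain ⟨j₀, hj₀⟩ : ∃ j, w (ε j) ≠ 0 := by
    by_contra! hall
    simp only [hall] at hsum
    exact zero_ne_one (hasSum_zero.unique hsum)
  -- Sets of weight zero may have the wrong size; they are replaced by a fixed good one so that the
  -- conditions hold for every `j`.
  refine ⟨fun j => w (ε j), fun j => if w (ε j) = 0 then S₁ j₀ else S₁ j, fun j => hw0 _, hsum,
    fun j => ?_, fun j => ?_, fun i => ?_⟩
  · beta_reduce
    split_ifs with hj
    exacts [hcard j₀ hj₀, hcard j hj]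
  · beta_reduce
    split_ifs with hj
    exacts [hpos₁ j₀ hj₀, hpos₁ j hj]
  · have h2 := ε.hasSum_iff.mpr (hwq (g i))
    rw [hg.extend_apply] at h2
    convert! h2 using 2 with j
    by_cases hj : w (ε j) = 0
    · simp [hj]
    · simp [hj, S₁]

end Sampling

/-! ### Finite orthonormal families -/

section Orthonormal

variable {H ι : Type*} [NormedAddCommGroup H] [InnerProductSpace ℂ H] [DecidableEq ι]

/-- Orthonormality is required on `s` only, because the Schmidt vectors in `B` are normalized only
where `p i > 0`. -/
theorem norm_sum_smul_sq {s : Finset ι} {v : ι → H}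
    (hv : ∀ i ∈ s, ∀ j ∈ s, ⟪v i, v j⟫_ℂ = if i = j then 1 else 0) (c : ι → ℂ) :
    ‖∑ i ∈ s, c i • v i‖ ^ 2 = ∑ i ∈ s, ‖c i‖ ^ 2 := by
  have h : ⟪∑ i ∈ s, c i • v i, ∑ i ∈ s, c i • v i⟫_ℂ = ((∑ i ∈ s, ‖c i‖ ^ 2 : ℝ) : ℂ) := by
    rw [sum_inner]
    push_cast
    refine Finset.sum_congr rfl fun i hi => ?_
    rw [inner_sum, Finset.sum_eq_single_of_mem i hi]
    · rw [inner_smul_left, inner_smul_right, hv i hi i hi, if_pos rfl, mul_one, Complex.conj_mul']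
    · intro j hj hji
      rw [inner_smul_left, inner_smul_right, hv i hi j hj, if_neg hji.symm, mul_zero, mul_zero]
  rw [inner_self_eq_norm_sq_to_K] at h
  refine Complex.ofReal_injective (Eq.trans ?_ h)
  push_cast
  rfl

theorem norm_sub_sum_inner_smul_sq {s : Finset ι} {v : ι → H}
    (hv : ∀ i ∈ s, ∀ j ∈ s, ⟪v i, v j⟫_ℂ = if i = j then 1 else 0) (b : H) :
    ‖b - ∑ i ∈ s, ⟪v i, b⟫_ℂ • v i‖ ^ 2 = ‖b‖ ^ 2 - ∑ i ∈ s, ‖⟪v i, b⟫_ℂ‖ ^ 2 := by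
  have h : ⟪b, ∑ i ∈ s, ⟪v i, b⟫_ℂ • v i⟫_ℂ = ((∑ i ∈ s, ‖⟪v i, b⟫_ℂ‖ ^ 2 : ℝ) : ℂ) := by
    rw [inner_sum]
    push_cast
    refine Finset.sum_congr rfl fun i _ => ?_
    rw [inner_smul_right, ← inner_conj_symm b, Complex.mul_conj']
  rw [@norm_sub_sq ℂ, h, norm_sum_smul_sq hv]
  simp only [RCLike.re_eq_complex_re, Complex.ofReal_re]
  ring

end Orthonormal

/-! ### Measurements and the two-round protocol -/

section Protocol

variable {A : QSystem.{u}} {B : QSystem.{v}} {ι : Type*}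

/-- A measurement whose outcome `0` maps one orthonormal family to another one, while the other
outcomes do not occur on the span of the first family. -/
theorem exists_measurement_map_orthonormal [DecidableEq ι] {s : Finset ι} {f g : ι → B}
    (hf : ∀ i ∈ s, ∀ j ∈ s, ⟪f i, f j⟫_ℂ = if i = j then 1 else 0)
    (hg : ∀ i ∈ s, ∀ j ∈ s, ⟪g i, g j⟫_ℂ = if i = j then 1 else 0) :
    ∃ M : Measurement B B, (∀ i ∈ s, M.K 0 (f i) = g i) ∧
      ∀ j ≠ 0, ∀ i ∈ s, M.K j (f i) = 0 := by
  -- `V` is a partial isometry from the span of `f` to that of `g`, and `W` projects onto the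
  -- complement of its initial space.
  let V : B →L[ℂ] B := ∑ i ∈ s, InnerProductSpace.rankOne ℂ (g i) (f i)
  let W : B →L[ℂ] B := ContinuousLinearMap.id ℂ B - ∑ i ∈ s, InnerProductSpace.rankOne ℂ (f i) (f i)
  have hV : ∀ b, V b = ∑ i ∈ s, ⟪f i, b⟫_ℂ • g i := fun b => by
    simp [V, sum_apply]
  have hW : ∀ b, W b = b - ∑ i ∈ s, ⟪f i, b⟫_ℂ • f i := fun b => by
    simp [W, sum_apply]
  have hsingle : ∀ (k : ι → B), ∀ i ∈ s, ∑ j ∈ s, ⟪f j, f i⟫_ℂ • k j = k i := fun k i hi => by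
    rw [Finset.sum_eq_single_of_mem i hi, hf i hi i hi, if_pos rfl, one_smul]
    intro j hj hji
    rw [hf j hj i hi, if_neg hji, zero_smul]
  refine ⟨⟨fun j => if j = 0 then V else if j = 1 then W else 0, fun b => ?_⟩, fun i hi => ?_,
    fun j hj i hi => ?_⟩
  · have h1 : ∑ j ∈ Finset.range 2, ‖(if j = 0 then V else if j = 1 then W else 0) b‖ ^ 2 =
        ‖b‖ ^ 2 := by
      simp only [Finset.sum_range_succ, Finset.range_zero, Finset.sum_empty, zero_add, if_true,
        one_ne_zero, if_false]
      rw [hV, hW, norm_sum_smul_sq hg, norm_sub_sum_inner_smul_sq hf]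
      ring
    rw [← h1]
    refine hasSum_sum_of_ne_finset_zero fun j hj => ?_
    rw [Finset.mem_range, not_lt] at hj
    rw [if_neg (by omega), if_neg (by omega)]
    simp
  · simp only [if_true]
    rw [hV, hsingle g i hi]
  · simp only [if_neg hj]
    split_ifs
    · rw [hW, hsingle f i hi, sub_self]
    · rfl

/-- A measurement with prescribed operators for the odd outcomes, if they are diagonal in absolute
value. The even outcomes complete it. -/
theorem exists_measurement_completing [Countable ι] (e : HilbertBasis ι ℂ A) {r : ι → ℝ}
    (hr : ∀ i, r i ≤ 1) {K : ℕ → A →L[ℂ] A}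
    (hK : ∀ a, HasSum (fun j => ‖K j a‖ ^ 2) (∑' i, r i * ‖⟪e i, a⟫_ℂ‖ ^ 2))
    (hs : ∀ a, Summable fun i => r i * ‖⟪e i, a⟫_ℂ‖ ^ 2) :
    ∃ (F : ℕ → A →L[ℂ] A) (M : Measurement A A),
      ∀ y, M.K (Equiv.natSumNatEquivNat y) = Sum.elim F K y := by
  classical
  obtain ⟨g, hg⟩ := exists_injective_nat ι
  -- The given operators have `∑ K* K = diag r`; the `D i` supply the missing `diag (1 - r)`.
  let D : ι → A →L[ℂ] A := fun i =>
    ((Real.sqrt (1 - r i) : ℝ) : ℂ) • InnerProductSpace.rankOne ℂ (e i) (e i)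
  have hD : ∀ i a, ‖D i a‖ ^ 2 = (1 - r i) * ‖⟪e i, a⟫_ℂ‖ ^ 2 := fun i a => by
    simp only [D, smul_apply, InnerProductSpace.rankOne_apply, norm_smul, e.orthonormal.1, mul_one,
      mul_pow]
    rw [Complex.norm_real, Real.norm_eq_abs, sq_abs, Real.sq_sqrt (by linarith [hr i])]
  let F : ℕ → A →L[ℂ] A := Function.extend g D 0
  have hF : ∀ a, HasSum (fun n => ‖F n a‖ ^ 2) (‖a‖ ^ 2 - ∑' i, r i * ‖⟪e i, a⟫_ℂ‖ ^ 2) := by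
    intro a
    have h1 : (fun n => ‖F n a‖ ^ 2) = Function.extend g (fun i => ‖D i a‖ ^ 2) 0 := by
      ext n
      by_cases hn : ∃ i, g i = n
      · obtain ⟨i, rfl⟩ := hn
        simp only [F, hg.extend_apply]
      · simp only [F, Function.extend_apply' _ _ _ hn]
        simp
    rw [h1, hasSum_extend_zero hg]
    convert! (hasSum_norm_inner_sq e a).sub (hs a).hasSum using 2 with i
    rw [hD]
    ring
  refine ⟨F, ⟨fun n => Sum.elim F K (Equiv.natSumNatEquivNat.symm n), fun a => ?_⟩, fun y => ?_⟩
  · rw [← Equiv.natSumNatEquivNat.hasSum_iff]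
    have h2 := HasSum.sum (f := fun y : ℕ ⊕ ℕ => ‖Sum.elim F K y a‖ ^ 2) (hF a) (hK a)
    rw [sub_add_cancel] at h2
    convert! h2 using 2 with y
    simp only [Function.comp_apply, Equiv.symm_apply_apply]
  · simp only [Equiv.symm_apply_apply]

/-- Superpositions of `L` products of orthonormal vectors are maximally entangled. -/
theorem isMaximallyEntangled_sum [DecidableEq ι] {e : ι → A} (he : Orthonormal ℂ e) {f : ι → B}
    {s : Finset ι}
    (hf : ∀ i ∈ s, ∀ j ∈ s, ⟪f i, f j⟫_ℂ = if i = j then 1 else 0) (hs : s.Nonempty) :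
    IsMaximallyEntangled
      (((Real.sqrt s.card)⁻¹ : ℂ) • ∑ i ∈ s, tprod (e i) (f i)) s.card := by
  classical
  have hL : (0 : ℝ) < s.card := by exact_mod_cast hs.card_pos
  have hsq : ((Real.sqrt s.card : ℝ) : ℂ) * (Real.sqrt s.card : ℝ) = (s.card : ℂ) := by
    rw [← Complex.ofReal_mul, Real.mul_self_sqrt hL.le]
    simp
  refine ⟨?_, Submodule.span ℂ (s.image e : Set A), inferInstance, ?_, ?_⟩
  · have h1 : ∀ i ∈ s, ∀ j ∈ s, ⟪tprod (e i) (f i), tprod (e j) (f j)⟫_ℂ = if i = j then 1 else 0 :=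
      fun i hi j hj => by
        rw [inner_tprod, orthonormal_iff_ite.mp he, hf i hi j hj]
        split_ifs <;> simp
    have h2 := norm_sum_smul_sq h1 (fun _ => 1)
    simp only [one_smul, norm_one, one_pow, Finset.sum_const, nsmul_eq_mul, mul_one] at h2
    have h3 : ‖∑ i ∈ s, tprod (e i) (f i)‖ = Real.sqrt s.card := by
      rw [← h2, Real.sqrt_sq (norm_nonneg _)]
    rw [norm_smul, h3, norm_inv, Complex.norm_real, Real.norm_eq_abs,
      abs_of_nonneg (Real.sqrt_nonneg _), inv_mul_cancel₀ (Real.sqrt_pos.mpr hL).ne']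
  · rw [Module.finrank_eq_card_basis (OrthonormalBasis.span he s).toBasis, Fintype.card_coe]
  · ext a'
    refine ext_inner_left ℂ fun a => ?_
    have hc : ∀ a, contract a (((Real.sqrt s.card)⁻¹ : ℂ) • ∑ i ∈ s, tprod (e i) (f i)) =
        ((Real.sqrt s.card)⁻¹ : ℂ) • ∑ i ∈ s, ⟪a, e i⟫_ℂ • f i := fun a => by
      simp only [contract, map_smul, map_sum]
      simp only [← contract.eq_1, contract_tprod]
    rw [inner_reducedDensity, hc, hc, smul_apply, inner_smul_right, inner_smul_left,
      inner_smul_right, (OrthonormalBasis.span he s).starProjection_eq_sum_rankOne]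
    simp only [OrthonormalBasis.span_apply, sum_apply, InnerProductSpace.rankOne_apply, inner_sum,
      inner_smul_right]
    rw [Finset.sum_coe_sort s fun i => ⟪e i, a'⟫_ℂ * ⟪a, e i⟫_ℂ, ← mul_assoc]
    congr 1
    · rw [map_inv₀, Complex.conj_ofReal, ← mul_inv, hsq]
    · refine Finset.sum_congr rfl fun i hi => ?_
      rw [sum_inner, Finset.sum_eq_single_of_mem i hi, inner_smul_left, hf i hi i hi, if_pos rfl,
        mul_one, inner_conj_symm, mul_comm]
      intro j hj hji
      rw [inner_smul_left, hf j hj i hi, if_neg hji, mul_zero]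

theorem trace_pureState {H : Type*} [NormedAddCommGroup H] [InnerProductSpace ℂ H]
    [CompleteSpace H] (ψ : H) : trace (pureState ψ) = ((‖ψ‖ ^ 2 : ℝ) : ℂ) :=
  trace_of_hasSum_pureState (v := fun _ : Unit => ψ) (hasSum_unique _) (hasSum_unique _)

theorem LOCC.failureProb_eq {n : ℕ} (P : LOCC A B n A B) (Φ : Tensor A B) :
    failureProb P Φ = ‖Φ‖ ^ 2 - (trace (P.instrument 1 (pureState Φ))).re := by
  obtain ⟨Ω, ⟨D⟩⟩ := P.exists_branches
  rw [failureProb, ← D.trace_add_trace Φ, add_sub_cancel_right]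

/-- The protocol in which Alice measures first, giving up for the outcomes on the left, and then
Bob measures, depending on the outcome on the right. -/
def twoRoundProtocol (M : Measurement A A) (N : ℕ → Measurement B B) : LOCC A B 2 A B :=
  .alice A M fun n => Sum.elim (fun _ => .finish 0)
    (fun j => .bob B (N j) fun _ => .finish 1) (Equiv.natSumNatEquivNat.symm n)

/-- If Bob's outcome is always `0` and yields a multiple of `Ψ`, the two-round protocol produces
`Ψ`. -/
theorem instrument_twoRoundProtocol {M : Measurement A A} {N : ℕ → Measurement B B}
    {F K : ℕ → A →L[ℂ] A} (hM : ∀ y, M.K (Equiv.natSumNatEquivNat y) = Sum.elim F K y)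
    {Φ Ψ : Tensor A B} {c : ℕ → ℂ}
    (h0 : ∀ j, tensorOp (ContinuousLinearMap.id ℂ A) ((N j).K 0)
      (tensorOp (K j) (ContinuousLinearMap.id ℂ B) Φ) = c j • Ψ)
    (h1 : ∀ j, ∀ l ≠ 0, tensorOp (ContinuousLinearMap.id ℂ A) ((N j).K l)
      (tensorOp (K j) (ContinuousLinearMap.id ℂ B) Φ) = 0)
    {t : ℝ} (ht : HasSum (fun j => ‖c j‖ ^ 2) t) :
    (twoRoundProtocol M N).instrument 1 (pureState Φ) = (t : ℂ) • pureState Ψ := by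
  rw [twoRoundProtocol, LOCC.instrument]
  simp_rw [comp_pureState_comp_adjoint]
  rw [← Equiv.natSumNatEquivNat.tsum_eq]
  simp_rw [Equiv.symm_apply_apply, hM]
  refine HasSum.tsum_eq ?_
  rw [← zero_add ((t : ℂ) • pureState Ψ)]
  refine HasSum.sum ?_ ?_
  · convert! hasSum_zero using 2
  · have h2 := (Complex.hasSum_ofReal.mpr ht).smul_const (pureState Ψ)
    convert! h2 using 2 with j
    simp only [Function.comp_apply, Sum.elim_inr, LOCC.instrument, if_true]
    simp_rw [comp_pureState_comp_adjoint]
    rw [tsum_eq_single 0, h0, pureState_smul]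
    intro l hl
    rw [h1 j l hl, pureState_zero]

end Protocol

/-! ### Attainment of the bound -/

section Achievability

variable {A : QSystem.{u}} {B : QSystem.{v}}

theorem exists_bijOn_of_card_eq {ι : Type*} {s t : Finset ι} (h : s.card = t.card) :
    ∃ τ : ι → ι, Set.BijOn τ s t := by
  classical
  let ε := Finset.equivOfCardEq h
  refine ⟨fun i => if hi : i ∈ s then (ε ⟨i, hi⟩ : ι) else i, fun i hi => ?_, fun i hi j hj hij => ?_,
    fun k hk => ?_⟩
  · have hi' : i ∈ s := hi
    simp [hi']
  · have hi' : i ∈ s := hi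
    have hj' : j ∈ s := hj
    simp only [hi', hj', dif_pos] at hij
    simpa using ε.injective (Subtype.ext hij)
  · refine ⟨ε.symm ⟨k, hk⟩, (ε.symm ⟨k, hk⟩).2, ?_⟩
    simp

/-- `p - max (p - x) 0 = min p x`. -/
theorem hasSum_min_eigenvalue {Φ : Tensor A B} {ι : Type*} {e : HilbertBasis ι ℂ A} {p : ι → ℝ}
    (he : ∀ i, reducedDensity Φ (e i) = (p i : ℂ) • e i) (hp : ∀ i, 0 ≤ p i) (hsum : HasSum p 1)
    {x : ℝ} (hx : 0 < x) :
    HasSum (fun i => min (p i) x) (1 - h (reducedDensity Φ) x) := by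
  have hh := hasSum_h (isSelfAdjoint_reducedDensity Φ) e he hp hsum.summable hx
  convert! hsum.sub hh using 2 with i
  rcases le_total (p i) x with hpx | hpx
  · rw [min_eq_left hpx, max_eq_right (by linarith), sub_zero]
  · rw [min_eq_right hpx, max_eq_left (by linarith)]; ring

theorem le_one_sub_h {Φ : Tensor A B} (hΦ : ‖Φ‖ = 1) {x : ℝ} (hx : 0 < x)
    (hx' : x ≤ ‖reducedDensity Φ‖) : x ≤ 1 - h (reducedDensity Φ) x := by
  obtain ⟨ι, -, e, p, he, hp, -, hsum⟩ := exists_schmidt Φ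
  rw [hΦ, one_pow] at hsum
  have hp0 : ∀ i, 0 ≤ p i := fun i => hp i ▸ by positivity
  obtain ⟨i, hi⟩ :=
    exists_le_eigenvalue (isSelfAdjoint_reducedDensity Φ) e he hp0 hsum.summable hx hx'
  have := le_hasSum (hasSum_min_eigenvalue he hp0 hsum hx) i fun j _ => le_min (hp0 j) hx.le
  rwa [min_eq_right hi] at this

theorem exists_isPFLEC {Φ : Tensor A B} (hΦ : ‖Φ‖ = 1) {x : ℝ} (hx : 0 < x) {L : ℕ} (hL : 0 < L)
    (hLx : L * x ≤ 1 - h (reducedDensity Φ) x) :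
    ∃ P : LOCC A B 2 A B, IsPFLEC P Φ L ∧ failureProb P Φ = h (reducedDensity Φ) x := by
  classical
  obtain ⟨ι, hι, e, p, he, hp, horth, hsum⟩ := exists_schmidt Φ
  rw [hΦ, one_pow] at hsum
  have hp0 : ∀ i, 0 ≤ p i := fun i => hp i ▸ by positivity
  have hmin := hasSum_min_eigenvalue he hp0 hsum hx
  set t : ℝ := 1 - h (reducedDensity Φ) x with ht
  have hLpos : (0 : ℝ) < L := by exact_mod_cast hL
  have ht0 : 0 < t := lt_of_lt_of_le (by positivity) hLx
  have hm0 : ∀ i, 0 ≤ min (p i) x := fun i => le_min (hp0 i) hx.le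
  -- `q i ≤ 1` is exactly where `L * x ≤ t` is used.
  obtain ⟨w, S, hw0, hw1, hcard, hpos, hq⟩ := exists_sampling (q := fun i => L / t * min (p i) x)
    (L := L) (fun i => mul_nonneg (by positivity) (hm0 i))
    (fun i => by
      calc L / t * min (p i) x ≤ L / t * x := by gcongr; exact min_le_right _ _
        _ = L * x / t := by ring
        _ ≤ 1 := (div_le_one ht0).mpr hLx)
    (by
      have := hmin.mul_left (L / t)
      rwa [div_mul_cancel₀ _ ht0.ne'] at this)
  have hppos : ∀ j, ∀ i ∈ S j, 0 < p i := fun j i hi => by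
    have h1 := hpos j i hi
    have h2 : 0 < min (p i) x := pos_of_mul_pos_right h1 (by positivity)
    exact h2.trans_le (min_le_left _ _)
  -- Relabelling every `S j` as `S 0` makes the final state independent of the outcome, hence pure.
  choose τ hτ using fun j => exists_bijOn_of_card_eq ((hcard j).trans (hcard 0).symm)
  have hτmem : ∀ j, ∀ i ∈ S j, τ j i ∈ S 0 := fun j i hi => (hτ j).mapsTo hi
  have hτinj : ∀ j, ∀ i ∈ S j, ∀ k ∈ S j, τ j i = τ j k ↔ i = k := fun j i hi k hk =>
    (hτ j).injOn.eq_iff hi hk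
  -- The Schmidt vectors in `B`; `f i = 0` where `p i = 0`, but the sets `S j` avoid such indices.
  let f : ι → B := fun i => ((Real.sqrt (p i) : ℝ) : ℂ)⁻¹ • contract (e i) Φ
  have hsqrt : ∀ {i}, 0 < p i → ((Real.sqrt (p i) : ℝ) : ℂ) ≠ 0 := fun {i} hi =>
    Complex.ofReal_ne_zero.mpr (Real.sqrt_pos.mpr hi).ne'
  have hcf : ∀ {i}, 0 < p i → contract (e i) Φ = ((Real.sqrt (p i) : ℝ) : ℂ) • f i :=
    fun {i} hi => by simp only [f]; rw [smul_smul, mul_inv_cancel₀ (hsqrt hi), one_smul]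
  have hf : ∀ i j, 0 < p i → 0 < p j → ⟪f i, f j⟫_ℂ = if i = j then 1 else 0 := fun i j hi hj => by
    simp only [f]
    rw [inner_smul_left, inner_smul_right]
    split_ifs with hij
    · subst hij
      rw [inner_self_eq_norm_sq_to_K, map_inv₀, Complex.conj_ofReal]
      have h1 : ((‖contract (e i) Φ‖ : ℝ) : ℂ) ^ 2 =
          ((Real.sqrt (p i) : ℝ) : ℂ) * ((Real.sqrt (p i) : ℝ) : ℂ) := by
        rw [← Complex.ofReal_mul, Real.mul_self_sqrt hi.le, ← hp i]
        push_cast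
        rfl
      have h2 := hsqrt hi
      change _ * (_ * ((‖contract (e i) Φ‖ : ℝ) : ℂ) ^ 2) = 1
      rw [h1]
      field_simp
    · rw [horth hij, mul_zero, mul_zero]
  choose N hN0 hN1 using fun j => exists_measurement_map_orthonormal (s := S j) (f := f)
    (g := fun i => f (τ j i)) (fun i hi k hk => hf i k (hppos j i hi) (hppos j k hk))
    (fun i hi k hk => by
      rw [hf _ _ (hppos 0 _ (hτmem j i hi)) (hppos 0 _ (hτmem j k hk))]
      simp only [hτinj j i hi k hk])
  -- The factor `1 / √(p i)` flattens the Schmidt coefficients. The constant `t / L` makes `∑ K* K`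
  -- equal to `diag (min (p i) x / p i)`, since `∑ w j` over `S j ∋ i` is `L / t * min (p i) x`.
  let K : ℕ → A →L[ℂ] A := fun j => ∑ i ∈ S j, ((Real.sqrt (t / L * w j / p i) : ℝ) : ℂ) •
    InnerProductSpace.rankOne ℂ (e (τ j i)) (e i)
  have hKnorm : ∀ j a, ‖K j a‖ ^ 2 = ∑ i ∈ S j, t / L * w j / p i * ‖⟪e i, a⟫_ℂ‖ ^ 2 := by
    intro j a
    have h1 : K j a = ∑ i ∈ S j, (((Real.sqrt (t / L * w j / p i) : ℝ) : ℂ) * ⟪e i, a⟫_ℂ) •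
        e (τ j i) := by
      simp only [K, sum_apply, smul_apply, InnerProductSpace.rankOne_apply, smul_smul]
    rw [h1, norm_sum_smul_sq]
    · refine Finset.sum_congr rfl fun i _ => ?_
      rw [norm_mul, mul_pow, Complex.norm_real, Real.norm_eq_abs, sq_abs, Real.sq_sqrt]
      exact div_nonneg (mul_nonneg (by positivity) (hw0 j)) (hp0 i)
    · intro i hi k hk
      rw [orthonormal_iff_ite.mp e.orthonormal]
      simp only [hτinj j i hi k hk]
  have hr1 : ∀ i, min (p i) x / p i ≤ 1 := fun i => div_le_one_of_le₀ (min_le_left _ _) (hp0 i)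
  have hr0 : ∀ i, 0 ≤ min (p i) x / p i := fun i => div_nonneg (hm0 i) (hp0 i)
  have hrs : ∀ a, Summable fun i => min (p i) x / p i * ‖⟪e i, a⟫_ℂ‖ ^ 2 := fun a =>
    Summable.of_nonneg_of_le (fun i => mul_nonneg (hr0 i) (by positivity))
      (fun i => mul_le_of_le_one_left (by positivity) (hr1 i)) (hasSum_norm_inner_sq e a).summable
  have hKsum : ∀ a, HasSum (fun j => ‖K j a‖ ^ 2)
      (∑' i, min (p i) x / p i * ‖⟪e i, a⟫_ℂ‖ ^ 2) := fun a => by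
    refine hasSum_comm_of_nonneg (f := fun i j => (if i ∈ S j then w j else 0) *
      (t / L / p i * ‖⟪e i, a⟫_ℂ‖ ^ 2)) (fun i j => ?_) (fun i => ?_) (hrs a).hasSum (fun j => ?_)
    · refine mul_nonneg (by split_ifs; exacts [hw0 j, le_rfl])
        (mul_nonneg (div_nonneg (by positivity) (hp0 i)) (by positivity))
    · convert! (hq i).mul_right (t / L / p i * ‖⟪e i, a⟫_ℂ‖ ^ 2) using 1
      have := ht0.ne'
      have := hLpos.ne'
      rw [show L / t * min (p i) x * (t / L / p i * ‖⟪e i, a⟫_ℂ‖ ^ 2) =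
        (L / t * (t / L)) * (min (p i) x / p i * ‖⟪e i, a⟫_ℂ‖ ^ 2) by ring,
        show (L : ℝ) / t * (t / L) = 1 by field_simp, one_mul]
    · rw [hKnorm, Finset.sum_congr rfl (g := fun i => (if i ∈ S j then w j else 0) *
        (t / L / p i * ‖⟪e i, a⟫_ℂ‖ ^ 2)) fun i hi => by rw [if_pos hi]; ring]
      exact hasSum_sum_of_ne_finset_zero fun i hi => by rw [if_neg hi, zero_mul]
  obtain ⟨F, M, hM⟩ := exists_measurement_completing e hr1 hKsum hrs
  set Ψ : Tensor A B := ((Real.sqrt (S 0).card)⁻¹ : ℂ) • ∑ i ∈ S 0, tprod (e i) (f i) with hΨdef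
  have hΨ : IsMaximallyEntangled Ψ L := by
    have := isMaximallyEntangled_sum e.orthonormal (f := f) (s := S 0)
      (fun i hi j hj => hf i j (hppos 0 i hi) (hppos 0 j hj))
      (Finset.card_pos.mp ((hcard 0).symm ▸ hL))
    rw [hΨdef]
    rwa [hcard 0] at this ⊢
  have hΦK : ∀ j, tensorOp (K j) (ContinuousLinearMap.id ℂ B) Φ =
      ∑ i ∈ S j, ((Real.sqrt (t / L * w j) : ℝ) : ℂ) • tprod (e (τ j i)) (f i) := fun j => by
    simp only [K, tensorOp_sum_left, tensorOp_smul_left, sum_apply, smul_apply,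
      tensorOp_rankOne_left]
    refine Finset.sum_congr rfl fun i hi => ?_
    have hpi := hppos j i hi
    rw [hcf hpi, tprod_smul_right, smul_smul, ← Complex.ofReal_mul, ← Real.sqrt_mul',
      div_mul_cancel₀ _ hpi.ne']
    exact hpi.le
  have hinst : (twoRoundProtocol M N).instrument 1 (pureState Φ) = (t : ℂ) • pureState Ψ := by
    refine instrument_twoRoundProtocol hM
      -- `√(t w j / L)` is the common coefficient left by `K j`, and `√L` undoes the normalization
      -- of `Ψ`; so `|c j|² = t w j`.
      (c := fun j => ((Real.sqrt (t / L * w j) : ℝ) : ℂ) * (Real.sqrt (S 0).card : ℝ))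
      (fun j => ?_) (fun j l hl => ?_) ?_
    · rw [hΦK]
      simp only [map_sum, map_smul, tensorOp_tprod, ContinuousLinearMap.id_apply]
      rw [hΨdef, smul_smul, mul_assoc, mul_inv_cancel₀, mul_one, Finset.smul_sum]
      · refine Finset.sum_nbij (τ j) (hτmem j) (hτ j).injOn (hτ j).surjOn fun i hi => ?_
        rw [hN0 j i hi]
      · rw [hcard 0]
        exact Complex.ofReal_ne_zero.mpr (Real.sqrt_pos.mpr hLpos).ne'
    · rw [hΦK]
      simp only [map_sum, map_smul, tensorOp_tprod, ContinuousLinearMap.id_apply]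
      refine Finset.sum_eq_zero fun i hi => ?_
      rw [hN1 j l hl i hi, ← tensorLeft_apply, map_zero, smul_zero]
    · convert! hw1.mul_left t using 2 with j
      · rw [norm_mul, mul_pow, Complex.norm_real, Complex.norm_real, Real.norm_eq_abs,
          Real.norm_eq_abs, sq_abs, sq_abs, Real.sq_sqrt (mul_nonneg (by positivity) (hw0 j)),
          Real.sq_sqrt (by positivity), hcard 0]
        field_simp
      · rw [mul_one]
  have htrace : trace ((twoRoundProtocol M N).instrument 1 (pureState Φ)) = t := by
    have h1 := trace_pureState (((Real.sqrt t : ℝ) : ℂ) • Ψ)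
    have h2 : ‖((Real.sqrt t : ℝ) : ℂ)‖ ^ 2 = t := by
      rw [Complex.norm_real, Real.norm_eq_abs, sq_abs, Real.sq_sqrt ht0.le]
    rw [pureState_smul, norm_smul, hΨ.1, mul_one, h2] at h1
    rw [hinst, h1]
  refine ⟨twoRoundProtocol M N, ⟨Ψ, hΨ, ?_⟩, ?_⟩
  · rw [htrace, hinst, smul_smul, inv_mul_cancel₀ (Complex.ofReal_ne_zero.mpr ht0.ne'), one_smul]
  · rw [LOCC.failureProb_eq, htrace, hΦ, Complex.ofReal_re, ht]
    ring

end Achievability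

end

end Entanglement

/-! ### The main theorem -/

theorem mainTheorem3 (A : QSystem.{u}) (B : QSystem.{v})
    (Φ : Entanglement.Tensor A B) (hΦ : ‖Φ‖ = 1)
    (x : ℝ) (hx : 0 < x) (hx' : x ≤ ‖Entanglement.reducedDensity Φ‖) :
    IsGreatest
      {L : ℕ | ∃ (n : ℕ) (P : Entanglement.LOCC A B n A B),
        Entanglement.IsPFLEC P Φ L ∧
          Entanglement.failureProb P Φ ≤ Entanglement.h (Entanglement.reducedDensity Φ) x}
      ⌊(1 - Entanglement.h (Entanglement.reducedDensity Φ) x) / x⌋₊ := by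
  refine ⟨?_, ?_⟩
  -- An eigenvalue at least `x` contributes `x` to `1 - h x`, so the floor is positive, as the
  -- construction requires.
  · have hle := Entanglement.le_one_sub_h hΦ hx hx'
    have h1 : 1 ≤ (1 - Entanglement.h (Entanglement.reducedDensity Φ) x) / x :=
      (one_le_div hx).mpr hle
    obtain ⟨P, hP, hfail⟩ := Entanglement.exists_isPFLEC hΦ hx (Nat.floor_pos.mpr h1)
      ((le_div_iff₀ hx).mp (Nat.floor_le (zero_le_one.trans h1)))
    exact ⟨2, P, hP, hfail.le⟩
  · rintro L ⟨n, P, hP, hfail⟩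
    exact Nat.le_floor ((le_div_iff₀ hx).mpr (hP.size_mul_le hΦ hx hx' hfail))
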